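/- All semigroups, groups and automata are finite. For $k\ge 0$ let $C_k$ be the class of semigroups of Krohn--Rhodes complexity at most $k$, i.e. those dividing (being a quotient of a subsemigroup of) an iterated wreath product of groups and aperiodic semigroups with at most $k$ group factors. A subset $Z$ of a semigroup $S$ is \emph{pointlike with respect to $C_k$} if for every $T\in C_k$ and every relational morphism $r\colon S\to T$ there is $t\in T$ with $Z\subseteq tr^{-1}$. A semigroup $S$ with zero is a \emph{$\mathrm{GM}$ semigroup with distinguished $\mathcal J$-class $J$} if $I(S)=J\cup\{0\}$ is a $0$-simple ideal of $S$, $S$ acts faithfully by right (left) multiplication on an $\mathcal R$-class ($\mathcal L$-class) contained in $J$, and the maximal subgroups in $J$ are non-trivial. Let $G$ be the maximal subgroup at an idempotent $e\in J$ and let $R$ be the $\mathcal R$-class of $e$. The group $G$ acts freely on the left of $R$, so $R$ is identified with $G\times B$, where $B$ is the set of $G$-orbits; $S$ acts on the right of $G\times B$ by partial functions. For $N\trianglelefteq G$ let $S/N$ be the quotient of $S$ by the least congruence that identifies elements of $G$ lying in the same coset of $N$. For $N\ne G$ let $\mathrm{GM}_J(G/N)$ be the quotient of $S/N$ by the congruence: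 $s\equiv t$ iff for all $x,y$ in the image $\bar J$ of $J$ one has $xsy\in\bar J\Leftrightarrow xty\in\bar J$, and then $xsy=xty$. Let $\mathrm{GM}_J(G/G)$ be the trivial semigroup. Write $G_N$ for the maximal subgroup of $\mathrm{GM}_J(G/N)$ at the image of $e$, and $G_N\times B_N$ for the $\mathcal R$-class of the image of $e$, as above. Fix a generating set $X$ of $S$. A \emph{flow} of $\mathrm{GM}_J(G/N)$ on a deterministic automaton with state set $Q$ and alphabet $X$ (each letter being a partial function on $Q$) assigns to each $q\in Q$ a pair $qf=(Y_q,\Pi_q)$, where $Y_q\subseteq G_N\times B_N$ and $\Pi_q$ is a partition of $Y_q$, such that $(Y_q,\Pi_q)$ is invariant under the left action of $G_N$; no $\Pi_q$-class contains $(g,b)$ and $(h,b)$ with $g\ne h$; and whenever $qx$ is defined, $Y_qx\subseteq Y_{qx}$ and, for $y,y'\in Y_q$ with $yx,y'x$ defined, $y,y'$ are in the same $\Pi_q$-class iff $yx,y'x$ are in the same $\Pi_{qx}$-class. It is \emph{complete} if it remains a flow when a sink state with value $(\emptyset,\emptyset)$ is added to receive all undefined transitions, and $\bigcup_q Y_q=G_N\times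 B_N$. We say that $\mathrm{GM}_J(G/N)$ \emph{admits a flow of complexity at most $m$} if it has a complete flow on an automaton with alphabet $X$ for which the semigroup of partial functions on $Q$ generated by the letters lies in $C_m$. \textbf{Theorem.} Let $k>0$ and let $S$ be a $\mathrm{GM}$ semigroup with distinguished $\mathcal J$-class $J$ and maximal subgroup $G$ of $J$. Let $N_J^{(k)}$ be the intersection of all normal subgroups $N$ of $G$ such that $\mathrm{GM}_J(G/N)$ admits a flow of complexity at most $k-1$. Then $N_J^{(k)}$ is itself such a normal subgroup, hence the smallest one, and it is the largest subgroup of $G$ that is pointlike with respect to $C_k$. -/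

import Mathlib

universe u

namespace KRComplexity

/-! ## Green's relations -/

section Green

variable {S : Type u} [Semigroup S]

/-- `s ≤ t` in the `𝒥`-order: `s ∈ S¹ t S¹`. -/
def JLe (s t : S) : Prop := ∃ x y : WithOne S, (s : WithOne S) = x * (t : WithOne S) * y

/-- `s ≤ t` in the `ℛ`-order: `s ∈ t S¹`. -/
def RLe (s t : S) : Prop := ∃ y : WithOne S, (s : WithOne S) = (t : WithOne S) * y

/-- `s ≤ t` in the `ℒ`-order: `s ∈ S¹ t`. -/
def LLe (s t : S) : Prop := ∃ x : WithOne S, (s : WithOne S) = x * (t : WithOne S)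

/-- The `𝒥`-class of `a`. -/
def JClass (a : S) : Set S := {s | JLe s a ∧ JLe a s}

/-- The `ℛ`-class of `a`. -/
def RClass (a : S) : Set S := {s | RLe s a ∧ RLe a s}

/-- The `ℒ`-class of `a`. -/
def LClass (a : S) : Set S := {s | LLe s a ∧ LLe a s}

theorem JLe.trans {a b c : S} (h : JLe a b) (h' : JLe b c) : JLe a c := by
  obtain ⟨x, y, h⟩ := h
  obtain ⟨x', y', h'⟩ := h'
  exact ⟨x * x', y' * y, by rw [h, h']; simp only [mul_assoc]⟩

theorem jLe_mul_right (a b : S) : JLe (a * b) a := ⟨1, b, by simp⟩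

theorem jLe_mul_left (a b : S) : JLe (a * b) b := ⟨a, 1, by simp⟩

/-- The local monoid `eSe` at an idempotent `e`. -/
@[ext] structure LocalMonoid {e : S} (he : IsIdempotentElem e) : Type u where
  val : S
  left_mul : e * val = val
  right_mul : val * e = val

instance {e : S} (he : IsIdempotentElem e) : Monoid (LocalMonoid he) where
  mul a b := ⟨a.val * b.val, by rw [← mul_assoc, a.left_mul], by rw [mul_assoc, b.right_mul]⟩
  mul_assoc a b c := LocalMonoid.ext (mul_assoc a.val b.val c.val)
  one := ⟨e, he, he⟩
  one_mul a := LocalMonoid.ext a.left_mul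
  mul_one a := LocalMonoid.ext a.right_mul

/-- The maximal subgroup `G_e` of `S` at the idempotent `e`: the group of units of `eSe`. -/
abbrev MaxSubgroup {e : S} (he : IsIdempotentElem e) : Type u := (LocalMonoid he)ˣ

/-- An element of the maximal subgroup at `e`, as an element of `S`. -/
def MaxSubgroup.elt {e : S} {he : IsIdempotentElem e} (g : MaxSubgroup he) : S :=
  (Units.val g).val

end Green

/-! ## Complexity -/

/-- A semigroup is aperiodic if all of its subgroups are trivial. -/
def IsAperiodic (S : Type u) [Semigroup S] : Prop :=
  ∀ (e : S) (he : IsIdempotentElem e), Subsingleton (MaxSubgroup he)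

/-- `S` divides `T`: `S` is a quotient of a subsemigroup of `T`. -/
def Divides (S T : Type u) [Semigroup S] [Semigroup T] : Prop :=
  ∃ (U : Subsemigroup T) (f : U →ₙ* S), Function.Surjective f

/-- A semigroup `Sgp` acting on the right of a set `State` by total functions. -/
structure TransSgp : Type (u + 1) where
  State : Type u
  Sgp : Type u
  [semigroup : Semigroup Sgp]
  act : State → Sgp → State
  act_mul : ∀ q s t, act q (s * t) = act (act q s) t

attribute [instance] TransSgp.semigroup

namespace TransSgp

/-- The one-point transformation semigroup. -/
def trivial : TransSgp.{u} where
  State := PUnit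
  Sgp := PUnit
  act _ _ := PUnit.unit
  act_mul _ _ _ := rfl

/-- A group acting on itself by right multiplication. -/
def ofGroup (G : Type u) [Group G] : TransSgp.{u} where
  State := G
  Sgp := G
  act q s := q * s
  act_mul q s t := (mul_assoc q s t).symm

/-- A semigroup `A` acting by right multiplication on `A` with an identity adjoined. -/
def ofSemigroup (A : Type u) [Semigroup A] : TransSgp.{u} where
  State := WithOne A
  Sgp := A
  act q s := q * (s : WithOne A)
  act_mul q s t := by rw [WithOne.coe_mul, mul_assoc]

/-- The semigroup `F(Q, T) × S` of the wreath product `(P, T) ≀ (Q, S)`. -/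
@[ext] structure WreathSgp (V W : TransSgp.{u}) : Type u where
  fst : W.State → V.Sgp
  snd : W.Sgp

instance (V W : TransSgp.{u}) : Semigroup (WreathSgp V W) where
  mul a b := ⟨fun q => a.fst q * b.fst (W.act q a.snd), a.snd * b.snd⟩
  mul_assoc a b c := by
    refine WreathSgp.ext (funext fun q => ?_) (mul_assoc _ _ _)
    change a.fst q * b.fst (W.act q a.snd) * c.fst (W.act q (a.snd * b.snd)) =
      a.fst q * (b.fst (W.act q a.snd) * c.fst (W.act (W.act q a.snd) b.snd))
    rw [W.act_mul, mul_assoc]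

/-- The wreath product `(P, T) ≀ (Q, S)`, with action `(p, q)(f, s) = (p(qf), qs)`. -/
def wreath (V W : TransSgp.{u}) : TransSgp.{u} where
  State := V.State × W.State
  Sgp := WreathSgp V W
  act p a := (V.act p.1 (a.fst p.2), W.act p.2 a.snd)
  act_mul _ _ _ := Prod.ext (V.act_mul _ _ _) (W.act_mul _ _ _)

end TransSgp

/-- `IsWreathProduct n W`: `W` is an iterated wreath product of finite groups and finite aperiodic
semigroups in which exactly `n` of the factors are used as groups. -/
inductive IsWreathProduct : ℕ → TransSgp.{u} → Prop
  | trivial : IsWreathProduct 0 TransSgp.trivial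
  | group (n : ℕ) (G : Type u) [Group G] [Finite G] (W : TransSgp.{u}) :
      IsWreathProduct n W → IsWreathProduct (n + 1) ((TransSgp.ofGroup G).wreath W)
  | aperiodic (n : ℕ) (A : Type u) [Semigroup A] [Finite A] (W : TransSgp.{u}) :
      IsAperiodic A → IsWreathProduct n W → IsWreathProduct n ((TransSgp.ofSemigroup A).wreath W)

/-- `S` has Krohn--Rhodes complexity at most `k`, that is, `S ∈ C_k`: it divides an iterated wreath
product of finite groups and finite aperiodic semigroups with at most `k` group factors. -/
def ComplexityLe (k : ℕ) (S : Type u) [Semigroup S] : Prop :=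
  ∃ (n : ℕ) (W : TransSgp.{u}), n ≤ k ∧ IsWreathProduct n W ∧ Divides S W.Sgp

/-! ## Pointlike sets -/

/-- A relational morphism of semigroups `S → T`. -/
structure RelMorphism (S T : Type u) [Semigroup S] [Semigroup T] where
  rel : S → T → Prop
  total : ∀ s, ∃ t, rel s t
  mul : ∀ s t s' t', rel s t → rel s' t' → rel (s * s') (t * t')

/-- `Z ⊆ S` is pointlike with respect to `C_k`. -/
def IsPointlike (k : ℕ) {S : Type u} [Semigroup S] (Z : Set S) : Prop :=
  ∀ (T : Type u) [Semigroup T] [Finite T], ComplexityLe k T →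
    ∀ r : RelMorphism S T, ∃ t : T, ∀ s ∈ Z, r.rel s t

/-! ## `GM` semigroups and the quotients `GM_J(G/N)` -/

/-- The semigroup with zero `S` is a `GM` (group mapping) semigroup with distinguished
`𝒥`-class `J`: the set `J ∪ {0}` is a `0`-simple ideal `I(S)`, `S` acts faithfully on the right of
an `ℛ`-class and on the left of an `ℒ`-class contained in `J` (by partial functions, a product
that is `0` being undefined), and the maximal subgroups in `J` are non-trivial. -/
structure IsGM {S : Type u} [SemigroupWithZero S] (J : Set S) : Prop where
  jClass : ∃ a : S, J = JClass a
  zero_notMem : (0 : S) ∉ J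
  mul_mem : ∀ a ∈ J, ∀ s : S, (a * s ∈ J ∨ a * s = 0) ∧ (s * a ∈ J ∨ s * a = 0)
  not_null : ∃ a ∈ J, ∃ b ∈ J, a * b ≠ 0
  right_faithful : ∃ a ∈ J, ∀ s t : S, (∀ r ∈ RClass a, r * s = r * t) → s = t
  left_faithful : ∃ a ∈ J, ∀ s t : S, (∀ l ∈ LClass a, s * l = t * l) → s = t
  nontrivial : ∀ (e : S) (he : IsIdempotentElem e), e ∈ J → Nontrivial (MaxSubgroup he)

section Quotients

variable {S : Type u} [Semigroup S]

/-- The congruence defining `S/N`, where `N` is a normal subgroup of the maximal subgroup `G` at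
the idempotent `e` with `𝒥`-class `J`. It is generated by identifying all elements of
the ideal `I(J) = {s | J ∩ S¹ s S¹ = ∅}` and identifying elements of `G` in the same coset of `N`. -/
def cosetCon {e : S} (he : IsIdempotentElem e) (N : Subgroup (MaxSubgroup he)) : Con S :=
  conGen fun s t =>
    ((∀ a ∈ JClass e, ¬ JLe a s) ∧ (∀ a ∈ JClass e, ¬ JLe a t)) ∨
    ∃ g h : MaxSubgroup he, g⁻¹ * h ∈ N ∧ s = g.elt ∧ t = h.elt

theorem mem_jClass_of_mul {e x s y : S} (hx : x ∈ JClass e) (h : x * s * y ∈ JClass e) :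
    x * s ∈ JClass e :=
  ⟨(jLe_mul_right x s).trans hx.1, h.2.trans (jLe_mul_right _ _)⟩

theorem mem_jClass_of_mul' {e x s y : S} (hy : y ∈ JClass e) (h : x * s * y ∈ JClass e) :
    s * y ∈ JClass e :=
  ⟨(jLe_mul_left s y).trans hy.1, h.2.trans (by rw [mul_assoc]; exact jLe_mul_left _ _)⟩

/-- The `GM` congruence associated to the `𝒥`-class `J` of `e`: `s ≡ t` if for all `x, y ∈ J`,
`xsy ∈ J` if and only if `xty ∈ J`, in which case `xsy = xty`. -/
def gmCon (e : S) : Con S where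
  r s t := ∀ x ∈ JClass e, ∀ y ∈ JClass e,
    (x * s * y ∈ JClass e ↔ x * t * y ∈ JClass e) ∧ (x * s * y ∈ JClass e → x * s * y = x * t * y)
  iseqv :=
    { refl := fun _ _ _ _ _ => ⟨Iff.rfl, fun _ => rfl⟩
      symm := fun h x hx y hy =>
        ⟨(h x hx y hy).1.symm, fun h' => ((h x hx y hy).2 ((h x hx y hy).1.2 h')).symm⟩
      trans := fun h h' x hx y hy =>
        ⟨(h x hx y hy).1.trans (h' x hx y hy).1, fun h₁ =>
          ((h x hx y hy).2 h₁).trans ((h' x hx y hy).2 ((h x hx y hy).1.1 h₁))⟩ }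
  mul' := by
    intro a b c d hab hcd x hx y hy
    have key : ∀ a b c d : S,
        (∀ x ∈ JClass e, ∀ y ∈ JClass e, (x * a * y ∈ JClass e ↔ x * b * y ∈ JClass e) ∧
          (x * a * y ∈ JClass e → x * a * y = x * b * y)) →
        (∀ x ∈ JClass e, ∀ y ∈ JClass e, (x * c * y ∈ JClass e ↔ x * d * y ∈ JClass e) ∧
          (x * c * y ∈ JClass e → x * c * y = x * d * y)) →
        x * (a * c) * y ∈ JClass e →
          x * (b * d) * y ∈ JClass e ∧ x * (a * c) * y = x * (b * d) * y := by
      intro a b c d hab hcd h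
      have e1 : ∀ u v : S, x * (u * v) * y = x * u * v * y := fun u v => by
        simp only [mul_assoc]
      have e2 : ∀ u v : S, x * (u * v) * y = x * u * (v * y) := fun u v => by
        simp only [mul_assoc]
      have h1 : x * a ∈ JClass e := by
        rw [e2] at h
        exact mem_jClass_of_mul hx h
      have h2 := hcd (x * a) h1 y hy
      rw [← e1, ← e1] at h2
      have h3 : x * (a * d) * y ∈ JClass e := h2.1.1 h
      have h4 : d * y ∈ JClass e := by
        rw [e1] at h3
        exact mem_jClass_of_mul' hy h3
      have h5 := hab x hx (d * y) h4
      rw [← e2, ← e2] at h5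
      exact ⟨h5.1.1 h3, (h2.2 h).trans (h5.2 h3)⟩
    refine ⟨⟨fun h => (key a b c d hab hcd h).1, fun h => (key b a d c ?_ ?_ h).1⟩,
      fun h => (key a b c d hab hcd h).2⟩
    · exact fun x hx y hy =>
        ⟨(hab x hx y hy).1.symm, fun h' => ((hab x hx y hy).2 ((hab x hx y hy).1.2 h')).symm⟩
    · exact fun x hx y hy =>
        ⟨(hcd x hx y hy).1.symm, fun h' => ((hcd x hx y hy).2 ((hcd x hx y hy).1.2 h')).symm⟩

open Classical in
/-- The congruence on `S` whose quotient is `GM_J(G/N)`: the `GM` congruence of `S/N` associated to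
the image of `J`, pulled back to `S`. By convention `GM_J(G/G)` is the trivial semigroup. -/
noncomputable def gmQuotCon {e : S} (he : IsIdempotentElem e) (N : Subgroup (MaxSubgroup he)) :
    Con S :=
  if N = ⊤ then ⊤
  else Con.comap (fun s => (s : (cosetCon he N).Quotient)) (fun _ _ => rfl)
    (gmCon (e : (cosetCon he N).Quotient))

/-- The semigroup `GM_J(G/N)`. -/
abbrev GMQuot {e : S} (he : IsIdempotentElem e) (N : Subgroup (MaxSubgroup he)) : Type u :=
  (gmQuotCon he N).Quotient

/-- The quotient map `S → GM_J(G/N)`. -/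
noncomputable def GMQuot.mk {e : S} (he : IsIdempotentElem e) (N : Subgroup (MaxSubgroup he)) (s : S) :
    GMQuot he N := (s : (gmQuotCon he N).Quotient)

theorem GMQuot.idem {e : S} (he : IsIdempotentElem e) (N : Subgroup (MaxSubgroup he)) :
    IsIdempotentElem (GMQuot.mk he N e) :=
  congrArg (GMQuot.mk he N) (he : e * e = e)

end Quotients

/-! ## Flows -/

/-- An element `(Y, Π)` of the set-partition lattice `SP(α)`: a partition `Π` of a subset `Y` of
`α`, given by the symmetric and transitive relation "`y` and `y'` lie in the same `Π`-class". -/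
structure SetPartition (α : Type u) where
  rel : α → α → Prop
  symm : ∀ y y', rel y y' → rel y' y
  trans : ∀ y y' y'', rel y y' → rel y' y'' → rel y y''

namespace SetPartition

/-- The underlying set `Y` of `(Y, Π)`. -/
def carrier {α : Type u} (P : SetPartition α) : Set α := {y | P.rel y y}

/-- The bottom `(∅, ∅)` of the set-partition lattice. -/
def bottom (α : Type u) : SetPartition α where
  rel _ _ := False
  symm _ _ h := h
  trans _ _ _ h _ := h

end SetPartition

/-- A finite deterministic automaton with alphabet `X`: every letter defines a partial function
on the state set. -/
structure Automaton (X : Type u) where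
  State : Type u
  [finite : Finite State]
  step : State → X → Option State

namespace Automaton

variable {X : Type u}

attribute [instance] Automaton.finite

/-- The completion: a sink state is added, and undefined transitions lead to the sink. -/
def completion (A : Automaton X) : Automaton X where
  State := Option A.State
  step q x := some (q.bind fun p => A.step p x)

/-- The partial function of a letter on the states, with "undefined" represented by `none`.
Passing to the opposite monoid makes products act from left to right. -/
def letter (A : Automaton X) (x : X) : (Function.End (Option A.State))ᵐᵒᵖ :=
  MulOpposite.op fun q => q.bind fun p => A.step p x

/-- The semigroup of the transformation semigroup of an automaton: the semigroup of partial
functions on the states generated by the letters. -/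
abbrev Sgp (A : Automaton X) : Type u := Subsemigroup.closure (Set.range A.letter)

end Automaton

section Flow

variable {S : Type u} [Semigroup S] {e : S} {X : Type u}

/-- Let `R` be the `ℛ`-class of the idempotent `e`. The maximal subgroup `G` at `e` acts freely on
the left of `R` by multiplication, so that `R` is identified with `G × B`, where `B` is the set of
orbits (equivalently, the set of `ℒ`-classes meeting `R`). A set-partition pair on
`R = G × B` is a cross-section if no class contains `(g, b)` and `(h, b)` with `g ≠ h`. -/
def IsCrossSection (he : IsIdempotentElem e) (P : SetPartition (RClass e)) : Prop :=
  ∀ y y' : RClass e, P.rel y y' → (∃ g : MaxSubgroup he, (y' : S) = g.elt * y) → y = y'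

/-- A set-partition pair `(Y, Π)` on `R = G × B` is invariant under the left action of `G`. -/
def IsInvariant (he : IsIdempotentElem e) (P : SetPartition (RClass e)) : Prop :=
  ∀ (g : MaxSubgroup he) (y y' z z' : RClass e), (z : S) = g.elt * y → (z' : S) = g.elt * y' →
    P.rel y y' → P.rel z z'

/-- A flow to `SP(G × B)` on an automaton `A` with alphabet `X`, where the letter `x` acts on
`R = G × B` by right multiplication by `ι x` (undefined if the product leaves `R`). -/
structure IsFlow (he : IsIdempotentElem e) (ι : X → S) (A : Automaton X)
    (f : A.State → SetPartition (RClass e)) : Prop where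
  mapsTo : ∀ q x q', A.step q x = some q' → ∀ y z : RClass e, y ∈ (f q).carrier →
    (z : S) = y * ι x → z ∈ (f q').carrier
  injective : ∀ q x q', A.step q x = some q' → ∀ y y' z z' : RClass e,
    y ∈ (f q).carrier → y' ∈ (f q).carrier → (z : S) = y * ι x → (z' : S) = y' * ι x →
    ((f q).rel y y' ↔ (f q').rel z z')
  crossSection : ∀ q, IsCrossSection he (f q)

/-- A complete flow: a flow that remains a flow on the completion when the sink is sent to
`(∅, ∅)`, and such that every element of `G × B` occurs at some state. -/
structure IsCompleteFlow (he : IsIdempotentElem e) (ι : X → S) (A : Automaton X)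
    (f : A.State → SetPartition (RClass e)) : Prop where
  flow : IsFlow he ι A f
  flow_completion : IsFlow he ι A.completion
    (fun q : Option A.State => q.elim (SetPartition.bottom (RClass e)) f)
  cover : ∀ y : RClass e, ∃ q, y ∈ (f q).carrier

/-- There is an automaton with alphabet `X` whose transformation semigroup has complexity at most
`k` with a complete flow to the Rhodes lattice `Rh_B(G)` (the `G`-invariant cross-sections in
`SP(G × B)`). -/
def AdmitsFlow (he : IsIdempotentElem e) (ι : X → S) (k : ℕ) : Prop :=
  ∃ A : Automaton X, ComplexityLe k A.Sgp ∧ ∃ f : A.State → SetPartition (RClass e),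
    IsCompleteFlow he ι A f ∧ ∀ q, IsInvariant he (f q)

/-- The set of normal subgroups `N` of `G` such that `GM_J(G/N)`, generated by the image of the
generating set `X` of `S`, admits a flow of complexity at most `k`. -/
def flowNormals (he : IsIdempotentElem e) (X : Set S) (k : ℕ) : Set (Subgroup (MaxSubgroup he)) :=
  {N | N.Normal ∧ AdmitsFlow (GMQuot.idem he N) (fun x : X => GMQuot.mk he N x) k}

/-- The `k`-th flow normal subgroup `N_J^{(k)}`, as a subgroup of the maximal subgroup at `e`. For
`k = 0` it is the whole group. -/
def flowNormal (he : IsIdempotentElem e) (X : Set S) : ℕ → Subgroup (MaxSubgroup he)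
  | 0 => ⊤
  | k + 1 => sInf (flowNormals he X k)

end Flow

end KRComplexity

namespace KRComplexity

/-! ## Finite semigroups -/

/-! Products and conjugates of pointlike subsets of $G$ are pointlike, so by finiteness there is a
largest pointlike subset $N$ of $G$ containing $1$, and it is a normal subgroup
(`exists_largest_isGroupPointlike`). It remains to see that $\mathrm{GM}_J(G/N)$ admits a flow of
complexity at most $k-1$, and that any $N'$ with such a flow contains every pointlike subgroup. Then
$N$ is the least flow normal subgroup, hence the intersection of all of them.

A flow bounds pointlike sets (`AdmitsFlow.subsingleton_of_isPointlike`). Each transition of the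
automaton induces a partial injection between partition classes, which extends to a permutation. A
wreath product in $C_{k-1}$ follows the automaton, and one further group factor records the
permutations. Group elements with a common image in this member of $C_k$ lie in one class, so they
are equal by the cross-section condition.

Conversely (`admitsFlow_of_pointlike_trivial`), the maximal subgroup of $\mathrm{GM}_J(G/N)$ has no
non-trivial pointlike subgroup (`gmQuot_isPointlike_eq_bot`), so one relational morphism into an
iterated wreath product separates them all. Its outer aperiodic factors can be dropped, because
finite groups are pointlike for aperiodic semigroups. What is left has the form $H\wr V$ with $V\in
C_{k-1}$ (`exists_graph_separating`). The flow lives on $V$: at $w$, two elements of $R$ share a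
class when some common left translate relates both to the same $(h,w)$. -/

theorem exists_isIdempotentElem_mem {S : Type*} [Semigroup S] [Finite S] (U : Set S)
    (hU : U.Nonempty) (hmul : ∀ a ∈ U, ∀ b ∈ U, a * b ∈ U) : ∃ i ∈ U, i * i = i := by
  let _ : TopologicalSpace S := ⊥
  have : DiscreteTopology S := ⟨rfl⟩
  exact exists_idempotent_in_compact_subsemigroup (fun _ => continuous_of_discreteTopology) U hU
    U.toFinite.isCompact hmul

theorem exists_pow_idempotent {S : Type*} [Monoid S] [Finite S] (a : S) :
    ∃ n, 0 < n ∧ a ^ n * a ^ n = a ^ n := by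
  obtain ⟨i, ⟨n, hn, rfl⟩, hi⟩ := exists_isIdempotentElem_mem {x : S | ∃ n, 0 < n ∧ x = a ^ n}
    ⟨a ^ 1, 1, one_pos, rfl⟩ (by
      rintro _ ⟨m, hm, rfl⟩ _ ⟨n, hn, rfl⟩
      exact ⟨m + n, by omega, (pow_add a m n).symm⟩)
  exact ⟨n, hn, hi⟩

/-- A finite semigroup contains an idempotent `f` such that `fS` is a minimal right ideal. -/
theorem exists_idempotent_minimal_right {S : Type*} [Semigroup S] [Finite S] (F : Set S)
    (hF : F.Nonempty) (hmul : ∀ a ∈ F, ∀ b ∈ F, a * b ∈ F) :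
    ∃ f ∈ F, f * f = f ∧ ∀ a ∈ F, f * a = a → ∃ b ∈ F, a * b = f := by
  -- Minimise $|aF|$. An idempotent found inside $aF$ then generates a minimal right ideal.
  obtain ⟨a, ha, hmin⟩ := Set.exists_min_image F (fun a => ((fun x => a * x) '' F).ncard)
    F.toFinite hF
  obtain ⟨_, ⟨x, hx, rfl⟩, hi⟩ := exists_isIdempotentElem_mem ((fun x => a * x) '' F)
    (hF.image _) (by
      rintro _ ⟨x, hx, rfl⟩ _ ⟨y, hy, rfl⟩
      exact ⟨x * (a * y), hmul _ hx _ (hmul _ ha _ hy), by simp only [mul_assoc]⟩)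
  refine ⟨a * x, hmul _ ha _ hx, hi, fun b hb hab => ?_⟩
  have hsub : (fun x => b * x) '' F ⊆ (fun x => a * x) '' F := by
    rintro _ ⟨y, hy, rfl⟩
    refine ⟨x * (b * y), hmul _ hx _ (hmul _ hb _ hy), ?_⟩
    change a * (x * (b * y)) = b * y
    rw [← mul_assoc, ← mul_assoc, hab]
  have heq := Set.eq_of_subset_of_ncard_le hsub (hmin b hb) (Set.toFinite _)
  have hmem : a * x ∈ (fun x => b * x) '' F := heq ▸ ⟨x, hx, rfl⟩
  exact hmem

theorem pow_eq_of_pow_succ_eq {U : Type*} [Monoid U] {u : U} {n : ℕ} (h : u ^ n = u ^ (n + 1))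
    {N : ℕ} (hN : n ≤ N) : u ^ N = u ^ (N + 1) := by
  obtain ⟨d, rfl⟩ := Nat.exists_eq_add_of_le hN
  rw [pow_add, h, ← pow_add]
  congr 1
  omega

/-- A finite group is pointlike with respect to aperiodic semigroups. -/
theorem exists_forall_rel_of_aperiodic {P U : Type*} [Group P] [Finite P] [Monoid U]
    (r : P → U → Prop) (mul : ∀ g u h v, r g u → r h v → r (g * h) (u * v))
    (total : ∀ g, ∃ u, r g u) (hap : ∀ g u, r g u → ∃ n, u ^ n = u ^ (n + 1)) :
    ∃ u, ∀ g, r g u := by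
  -- Take $u$ related to $1$ with the most preimages. For any $g$, a high power $b$ of some $uu'$
  -- related to $g$ is related to both $1$ and $g$ by aperiodicity. So $ub$ has all preimages of $u$
  -- and also $g$, and maximality puts $g$ among those of $u$.
  have hpow : ∀ g u, r g u → ∀ n, r (g ^ (n + 1)) (u ^ (n + 1)) := by
    intro g u h n
    induction n with
    | zero => simpa using h
    | succ n ih => rw [pow_succ g, pow_succ u]; exact mul _ _ _ _ ih h
  obtain ⟨_, ⟨u, hu, rfl⟩, hmax⟩ := Set.exists_max_image
    ((fun u => {g | r g u}) '' {u | r 1 u}) Set.ncard (Set.toFinite _)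
    (Set.Nonempty.image _ (total 1))
  refine ⟨u, fun g => ?_⟩
  obtain ⟨u', hu'⟩ := total g
  have ha : r g (u * u') := by simpa using mul _ _ _ _ hu hu'
  obtain ⟨n, hn⟩ := hap _ _ ha
  obtain ⟨m, hm⟩ : ∃ m, Nat.card P * (n + 1) = m + 1 :=
    Nat.exists_eq_succ_of_ne_zero (Nat.mul_ne_zero Nat.card_pos.ne' (by omega))
  have hnm : n ≤ m + 1 := by
    have : 1 * (n + 1) ≤ Nat.card P * (n + 1) := Nat.mul_le_mul_right _ Nat.card_pos
    omega
  have hg : g ^ (m + 1) = 1 := by rw [← hm, pow_mul, pow_card_eq_one', one_pow]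
  set b := (u * u') ^ (m + 1) with hb
  have h1 : r 1 b := hg ▸ hpow _ _ ha m
  have h2 : r g b := by
    have := hpow _ _ ha (m + 1)
    rwa [← pow_eq_of_pow_succ_eq hn hnm, pow_succ g, hg, one_mul] at this
  have hsub : {g | r g u} ⊆ {g | r g (u * b)} := fun h hh => by
    simpa using mul _ _ _ _ hh h1
  have heq := Set.eq_of_subset_of_ncard_le hsub
    (hmax _ ⟨u * b, hsub hu, rfl⟩) (Set.toFinite _)
  have : g ∈ {g | r g (u * b)} := by simpa using mul _ _ _ _ hu h2
  rwa [← heq] at this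

theorem eq_one_or_coe {S : Type*} (x : WithOne S) : x = 1 ∨ ∃ s : S, x = s :=
  WithOne.cases_on x (Or.inl rfl) fun s => Or.inr ⟨s, rfl⟩

/-! ## Division and complexity -/

/-- Relational form of division: the subsemigroup is the domain of the relation, so no choice of
representatives has to be multiplicative. -/
theorem Divides.of_rel {S T : Type u} [Semigroup S] [Semigroup T] (r : T → S → Prop)
    (mul : ∀ t s t' s', r t s → r t' s' → r (t * t') (s * s'))
    (functional : ∀ t s s', r t s → r t s' → s = s') (surj : ∀ s, ∃ t, r t s) :
    Divides S T := by
  let U : Subsemigroup T := ⟨{t | ∃ s, r t s}, by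
    rintro a b ⟨s, hs⟩ ⟨s', hs'⟩
    exact ⟨s * s', mul _ _ _ _ hs hs'⟩⟩
  refine ⟨U, ⟨fun t => t.2.choose, fun a b => ?_⟩, fun s => ?_⟩
  · exact functional _ _ _ (a * b).2.choose_spec
      (mul _ _ _ _ a.2.choose_spec b.2.choose_spec)
  · obtain ⟨t, ht⟩ := surj s
    have hs : ∃ s, r t s := ⟨s, ht⟩
    exact ⟨⟨t, hs⟩, functional _ _ _ hs.choose_spec ht⟩

theorem Divides.refl (S : Type u) [Semigroup S] : Divides S S :=
  Divides.of_rel (fun t s => t = s) (by rintro _ _ _ _ rfl rfl; rfl) (by rintro _ _ _ rfl rfl; rfl)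
    fun s => ⟨s, rfl⟩

theorem IsAperiodic.eq_of_mul {A : Type u} [Semigroup A] (hA : IsAperiodic A) {i g g' : A}
    (hi : IsIdempotentElem i) (hig : i * g = g) (hgi : g * i = g) (hgg : g * g' = i) (hgg' : g' * g = i) :
    g = i := by
  have := hA i hi
  let x : LocalMonoid (e := i) hi := ⟨g, hig, hgi⟩
  let y : LocalMonoid (e := i) hi := ⟨i * g' * i, by rw [← mul_assoc, ← mul_assoc, hi.eq], by
    rw [mul_assoc, hi.eq]⟩
  have hxy : x * y = 1 := LocalMonoid.ext (by
    change g * (i * g' * i) = i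
    rw [← mul_assoc, ← mul_assoc, hgi, hgg, hi.eq])
  have hyx : y * x = 1 := LocalMonoid.ext (by
    change i * g' * i * g = i
    rw [mul_assoc, hig, mul_assoc, hgg', hi.eq])
  have h : (⟨x, y, hxy, hyx⟩ : MaxSubgroup (e := i) hi) = 1 := Subsingleton.elim _ _
  exact congrArg (fun z : MaxSubgroup (e := i) hi => z.val.val) h

theorem isAperiodic_of_eq {A : Type u} [Semigroup A]
    (h : ∀ i g g' : A, i * i = i → i * g = g → g * i = g → g * g' = i → g' * g = i → g = i) :
    IsAperiodic A := by
  intro e he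
  have key : ∀ g : MaxSubgroup he, g = 1 := fun g => Units.ext (LocalMonoid.ext
    (h e g.val.val g.inv.val he g.val.left_mul g.val.right_mul
      (congrArg LocalMonoid.val g.val_inv) (congrArg LocalMonoid.val g.inv_val)))
  exact ⟨fun a b => (key a).trans (key b).symm⟩

theorem IsAperiodic.pi {A : Type u} [Semigroup A] (hA : IsAperiodic A) (Q : Type u) :
    IsAperiodic (Q → A) :=
  isAperiodic_of_eq fun _ _ _ h1 h2 h3 h4 h5 => funext fun q =>
    hA.eq_of_mul (congrFun h1 q) (congrFun h2 q) (congrFun h3 q) (congrFun h4 q) (congrFun h5 q)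

theorem isAperiodic_punit : IsAperiodic PUnit.{u + 1} :=
  isAperiodic_of_eq fun _ _ _ _ _ _ _ _ => rfl

/-! ### Wreath products: faithfulness, covers of direct products, tracking of the element read. -/

namespace TransSgp

instance (V W : TransSgp.{u}) [Finite W.State] [Finite V.Sgp] [Finite W.Sgp] :
    Finite (WreathSgp V W) :=
  Finite.of_injective (fun s : WreathSgp V W => (s.fst, s.snd)) fun _ _ h =>
    WreathSgp.ext (congrArg Prod.fst h) (congrArg Prod.snd h)

/-- The projection of a wreath product onto its second factor. -/
def sndHom (V W : TransSgp.{u}) : (V.wreath W).Sgp →ₙ* W.Sgp where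
  toFun := WreathSgp.snd
  map_mul' _ _ := rfl

/-- The action of the semigroup with an identity adjoined. -/
def actOne (W : TransSgp.{u}) (q : W.State) (s : WithOne W.Sgp) : W.State :=
  WithOne.recOneCoe q (fun s => W.act q s) s

/-- An element of a wreath product with an identity adjoined, from its two coordinates. -/
def pairOne (V W : TransSgp.{u}) (F : W.State → V.Sgp) (s : WithOne W.Sgp) :
    WithOne (WreathSgp V W) :=
  WithOne.recOneCoe 1 (fun w => ((⟨F, w⟩ : WreathSgp V W) : WithOne (WreathSgp V W))) s

/-- The action is faithful and there is a state. -/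
def IsFaithful (W : TransSgp.{u}) : Prop :=
  Nonempty W.State ∧ ∀ s t, (∀ p, W.act p s = W.act p t) → s = t

theorem IsFaithful.wreath {V W : TransSgp.{u}} (hV : V.IsFaithful) (hW : W.IsFaithful) :
    (V.wreath W).IsFaithful := by
  obtain ⟨⟨v⟩, hV⟩ := hV
  obtain ⟨⟨w⟩, hW⟩ := hW
  refine ⟨⟨(v, w)⟩, fun s t h => ?_⟩
  exact WreathSgp.ext (funext fun q => hV _ _ fun p => congrArg Prod.fst (h (p, q)))
    (hW _ _ fun q => congrArg Prod.snd (h (v, q)))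

theorem isFaithful_ofGroup (G : Type u) [Group G] : (ofGroup G).IsFaithful :=
  ⟨⟨(1 : G)⟩, fun s t h => by
    change G at s t
    exact mul_left_cancel (a := (1 : G)) (h (1 : G))⟩

theorem isFaithful_ofSemigroup (A : Type u) [Semigroup A] : (ofSemigroup A).IsFaithful :=
  ⟨⟨(1 : WithOne A)⟩, fun s t h => by
    change A at s t
    refine (WithOne.coe_inj (α := A)).1 ?_
    have := h (1 : WithOne A)
    change (1 : WithOne A) * (s : A) = 1 * (t : A) at this
    simpa only [one_mul] using this⟩

/-- `U` covers the direct product of `V` and `W`. -/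
def IsProdCover (U V W : TransSgp.{u}) : Prop :=
  ∃ (θ : U.State → V.State) (η : U.State → W.State), (∀ p q, ∃ x, θ x = p ∧ η x = q) ∧
    ∀ s t, ∃ a, ∀ x, θ (U.act x a) = V.act (θ x) s ∧ η (U.act x a) = W.act (η x) t

end TransSgp

open TransSgp

namespace IsWreathProduct

theorem isFaithful {n : ℕ} {W : TransSgp.{u}} (h : IsWreathProduct n W) : W.IsFaithful := by
  induction h with
  | trivial => exact ⟨⟨PUnit.unit⟩, fun _ _ _ => rfl⟩
  | group n G W h ih => exact (isFaithful_ofGroup G).wreath ih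
  | aperiodic n A W hA h ih => exact (isFaithful_ofSemigroup A).wreath ih

theorem finite {n : ℕ} {W : TransSgp.{u}} (h : IsWreathProduct n W) :
    Finite W.State ∧ Finite W.Sgp := by
  induction h with
  | trivial => exact ⟨inferInstanceAs (Finite PUnit), inferInstanceAs (Finite PUnit)⟩
  | group n G W h ih =>
    obtain ⟨_, _⟩ := ih
    have : Finite (ofGroup G).Sgp := inferInstanceAs (Finite G)
    exact ⟨inferInstanceAs (Finite (G × W.State)), inferInstanceAs (Finite (WreathSgp _ _))⟩
  | aperiodic n A W hA h ih =>
    obtain ⟨_, _⟩ := ih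
    have : Finite (ofSemigroup A).Sgp := inferInstanceAs (Finite A)
    exact ⟨inferInstanceAs (Finite (Option A × W.State)), inferInstanceAs (Finite (WreathSgp _ _))⟩

/-- Outer aperiodic factors are peeled off either side one at a time. When both outer factors are
groups they merge into the single group factor `G × H`, which is why the count is the maximum and
not the sum. -/
theorem exists_isProdCover {m : ℕ} {V : TransSgp.{u}} (hV : IsWreathProduct m V) :
    ∀ {n : ℕ} {W : TransSgp.{u}}, IsWreathProduct n W →
      ∃ (l : ℕ) (U : TransSgp.{u}), l ≤ max m n ∧ IsWreathProduct l U ∧ IsProdCover U V W := by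
  induction hV with
  | trivial =>
    intro n W hW
    exact ⟨n, W, by omega, hW, fun _ => PUnit.unit, id, fun _ q => ⟨q, rfl, rfl⟩,
      fun _ t => ⟨t, fun _ => ⟨rfl, rfl⟩⟩⟩
  | aperiodic m A V hA hV ih =>
    intro n W hW
    obtain ⟨l, U, hl, hU, θ, η, hs, ha⟩ := ih hW
    refine ⟨l, _, hl, hU.aperiodic l A U hA, fun x => (x.1, θ x.2), fun x => η x.2, ?_, ?_⟩
    · rintro ⟨a, p⟩ q
      obtain ⟨x, rfl, rfl⟩ := hs p q
      exact ⟨(a, x), rfl, rfl⟩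
    · intro s t
      obtain ⟨a, h⟩ := ha s.snd t
      exact ⟨⟨fun x => s.fst (θ x), a⟩, fun x => ⟨Prod.ext rfl (h x.2).1, (h x.2).2⟩⟩
  | group m G V hV ihV =>
    intro n W hW
    induction hW with
    | trivial =>
      exact ⟨m + 1, (ofGroup G).wreath V, by omega, hV.group m G V, id, fun _ => PUnit.unit,
        fun p _ => ⟨p, rfl, rfl⟩, fun s _ => ⟨s, fun _ => ⟨rfl, rfl⟩⟩⟩
    | aperiodic n A W hA hW ih =>
      obtain ⟨l, U, hl, hU, θ, η, hs, ha⟩ := ih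
      refine ⟨l, _, hl, hU.aperiodic l A U hA, fun x => θ x.2, fun x => (x.1, η x.2), ?_, ?_⟩
      · rintro p ⟨a, q⟩
        obtain ⟨x, rfl, rfl⟩ := hs p q
        exact ⟨(a, x), rfl, rfl⟩
      · intro s t
        obtain ⟨a, h⟩ := ha s t.snd
        exact ⟨⟨fun x => t.fst (η x), a⟩, fun x => ⟨(h x.2).1, Prod.ext rfl (h x.2).2⟩⟩
    | group n H W hW ih =>
      obtain ⟨l, U, hl, hU, θ, η, hs, ha⟩ := ihV hW
      refine ⟨l + 1, _, by omega, hU.group l (G × H) U, fun x => (x.1.1, θ x.2),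
        fun x => (x.1.2, η x.2), ?_, ?_⟩
      · rintro ⟨g, p⟩ ⟨h, q⟩
        obtain ⟨x, rfl, rfl⟩ := hs p q
        exact ⟨((g, h), x), rfl, rfl⟩
      · intro s t
        obtain ⟨a, h⟩ := ha s.snd t.snd
        exact ⟨⟨fun x => (s.fst (θ x), t.fst (η x)), a⟩,
          fun x => ⟨Prod.ext rfl (h x.2).1, Prod.ext rfl (h x.2).2⟩⟩

/-- Every iterated wreath product `W` has a cover `V` with the same number of group factors and a
base point from which the state reached determines the element of `W` read so far. -/
theorem exists_tracking {n : ℕ} {W : TransSgp.{u}} (hW : IsWreathProduct n W) :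
    ∃ V : TransSgp.{u}, IsWreathProduct n V ∧ ∃ (D : Set V.State) (θ : V.State → WithOne W.Sgp)
      (lift : W.Sgp → V.Sgp), (∃ p ∈ D, θ p = 1) ∧
      ∀ p ∈ D, ∀ s, V.act p (lift s) ∈ D ∧ θ (V.act p (lift s)) = θ p * (s : WithOne W.Sgp) := by
  induction hW with
  | trivial =>
    -- One state cannot distinguish "nothing read" from "something read". The adjoined identity of
    -- an extra trivial aperiodic factor supplies the distinction.
    refine ⟨(ofSemigroup PUnit).wreath TransSgp.trivial,
      .aperiodic 0 _ _ isAperiodic_punit .trivial, Set.univ, fun p => p.1,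
      fun _ => ⟨fun _ => PUnit.unit, PUnit.unit⟩,
      ⟨((1 : WithOne PUnit), PUnit.unit), Set.mem_univ _, rfl⟩,
      fun p _ s => ⟨Set.mem_univ _, rfl⟩⟩
  | group n G W hW ih =>
    obtain ⟨V, hV, D, θ, lift, ⟨p₀, hp₀, hθ₀⟩, h⟩ := ih
    have := hW.finite.1
    -- The factor `G` becomes a power of `G`, which stores the whole first coordinate of the product
    -- read so far. A group has no spare state for the empty product, so `D` requires the value `1`
    -- there.
    refine ⟨(ofGroup (W.State → G)).wreath V, hV.group n _ V,
      {x | x.2 ∈ D ∧ (θ x.2 = 1 → x.1 = (1 : W.State → G))},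
      fun x => pairOne (ofGroup G) W x.1 (θ x.2),
      fun s => ⟨fun p => fun q => s.fst (W.actOne q (θ p)), lift s.snd⟩,
      ⟨((1 : W.State → G), p₀), ⟨hp₀, fun _ => rfl⟩, by simp only [hθ₀]; rfl⟩, ?_⟩
    rintro ⟨F, p⟩ ⟨hp, hF⟩ s
    obtain ⟨h1, h2⟩ := h p hp s.snd
    change W.State → G at F
    obtain hθ | ⟨w, hθ⟩ := eq_one_or_coe (θ p)
    · obtain rfl : F = 1 := hF hθ
      rw [hθ, one_mul] at h2
      refine ⟨⟨h1, fun h3 => absurd (h2.symm.trans h3) WithOne.coe_ne_one⟩, ?_⟩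
      let f : W.State → G := fun q => s.fst (W.actOne q (θ p))
      change pairOne (ofGroup G) W (1 * f : W.State → G) (θ (V.act p _)) =
        pairOne (ofGroup G) W (1 : W.State → G) (θ p) * _
      rw [h2, hθ, one_mul]
      change pairOne (ofGroup G) W (fun q => s.fst (W.actOne q (θ p))) _ = _
      rw [hθ]
      exact (one_mul _).symm
    · rw [hθ, ← WithOne.coe_mul] at h2
      refine ⟨⟨h1, fun h3 => absurd (h2.symm.trans h3) WithOne.coe_ne_one⟩, ?_⟩
      let f : W.State → G := fun q => s.fst (W.actOne q (θ p))
      change pairOne (ofGroup G) W (F * f : W.State → G) (θ (V.act p _)) =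
        pairOne (ofGroup G) W F (θ p) * _
      have hf : f = fun q => s.fst (W.act q w) := by
        funext q
        change s.fst (W.actOne q (θ p)) = _
        rw [hθ]
        rfl
      rw [h2, hθ, hf]
      rfl
  | aperiodic n A W hA hW ih =>
    obtain ⟨V, hV, D, θ, lift, ⟨p₀, hp₀, hθ₀⟩, h⟩ := ih
    have := hW.finite.1
    -- Here the adjoined identity marks the empty product; `D` keeps it in step with `θ`.
    let τ : WithOne (W.State → A) → WithOne W.Sgp → WithOne (WreathSgp (ofSemigroup A) W) :=
      fun F s => WithOne.recOneCoe 1 (fun F => pairOne (ofSemigroup A) W F s) F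
    refine ⟨(ofSemigroup (W.State → A)).wreath V, hV.aperiodic n _ V (hA.pi _),
      {x | x.2 ∈ D ∧ ((x.1 = (1 : WithOne (W.State → A)) ∧ θ x.2 = 1) ∨
        ∃ (F : W.State → A) (w : W.Sgp), x.1 = (F : WithOne (W.State → A)) ∧ θ x.2 = w)},
      fun x => τ x.1 (θ x.2),
      fun s => ⟨fun p => fun q => s.fst (W.actOne q (θ p)), lift s.snd⟩,
      ⟨((1 : WithOne (W.State → A)), p₀), ⟨hp₀, Or.inl ⟨rfl, hθ₀⟩⟩, rfl⟩, ?_⟩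
    rintro ⟨F, p⟩ ⟨hp, hF⟩ s
    obtain ⟨h1, h2⟩ := h p hp s.snd
    let f : W.State → A := fun q => s.fst (W.actOne q (θ p))
    rcases hF with ⟨hF, hθ⟩ | ⟨F', w, hF, hθ⟩
    · change F = _ at hF
      change θ p = _ at hθ
      subst hF
      rw [hθ, one_mul] at h2
      refine ⟨⟨h1, Or.inr ⟨f, _, one_mul (f : WithOne (W.State → A)), h2⟩⟩, ?_⟩
      change τ ((1 : WithOne (W.State → A)) * (f : WithOne (W.State → A))) (θ (V.act p _)) = 1 * _
      rw [h2, one_mul]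
      have hf : f = s.fst := by
        funext q
        change s.fst (W.actOne q (θ p)) = _
        rw [hθ]
        rfl
      rw [hf]
      exact (one_mul _).symm
    · change F = _ at hF
      change θ p = _ at hθ
      subst hF
      rw [hθ, ← WithOne.coe_mul] at h2
      refine ⟨⟨h1, Or.inr ⟨_, _, (WithOne.coe_mul F' f).symm, h2⟩⟩, ?_⟩
      change pairOne (ofSemigroup A) W (F' * f : W.State → A) (θ (V.act p _)) =
        pairOne (ofSemigroup A) W F' (θ p) * _
      have hf : f = fun q => s.fst (W.act q w) := by
        funext q
        change s.fst (W.actOne q (θ p)) = _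
        rw [hθ]
        rfl
      rw [h2, hθ, hf]
      rfl

end IsWreathProduct

theorem ComplexityLe.punit (k : ℕ) : ComplexityLe k PUnit.{u + 1} :=
  ⟨0, TransSgp.trivial, Nat.zero_le k, .trivial, Divides.refl _⟩

/-- Needed to combine finitely many separating relational morphisms into one without raising the
complexity. Faithfulness of both actions makes the covering relation functional. -/
theorem ComplexityLe.prod {k : ℕ} {S T : Type u} [Semigroup S] [Semigroup T]
    (hS : ComplexityLe k S) (hT : ComplexityLe k T) : ComplexityLe k (S × T) := by
  obtain ⟨m, V, hm, hV, A, f, hf⟩ := hS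
  obtain ⟨n, W, hn, hW, B, g, hg⟩ := hT
  obtain ⟨l, U, hl, hU, θ, η, hs, ha⟩ := hV.exists_isProdCover hW
  refine ⟨l, U, by omega, hU, Divides.of_rel (fun u x => ∃ (a : A) (b : B),
    (∀ p, θ (U.act p u) = V.act (θ p) a ∧ η (U.act p u) = W.act (η p) b) ∧ f a = x.1 ∧ g b = x.2)
    ?_ ?_ ?_⟩
  · rintro u x u' x' ⟨a, b, h, hfa, hgb⟩ ⟨a', b', h', hfa', hgb'⟩
    refine ⟨a * a', b * b', fun p => ?_, by rw [map_mul, hfa, hfa']; rfl,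
      by rw [map_mul, hgb, hgb']; rfl⟩
    rw [U.act_mul, (h' _).1, (h' _).2, (h _).1, (h _).2]
    exact ⟨(V.act_mul _ _ _).symm, (W.act_mul _ _ _).symm⟩
  · rintro u ⟨x, y⟩ ⟨x', y'⟩ ⟨a, b, h, rfl, rfl⟩ ⟨a', b', h', rfl, rfl⟩
    have hxy : ∀ p q, V.act p a = V.act p a' ∧ W.act q b = W.act q b' := by
      intro p q
      obtain ⟨z, rfl, rfl⟩ := hs p q
      exact ⟨(h z).1.symm.trans (h' z).1, (h z).2.symm.trans (h' z).2⟩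
    obtain ⟨⟨v⟩, hVf⟩ := hV.isFaithful
    obtain ⟨⟨w⟩, hWf⟩ := hW.isFaithful
    obtain rfl : a = a' := Subtype.ext (hVf _ _ fun p => (hxy p w).1)
    obtain rfl : b = b' := Subtype.ext (hWf _ _ fun q => (hxy v q).2)
    rfl
  · rintro ⟨x, y⟩
    obtain ⟨a, rfl⟩ := hf x
    obtain ⟨b, rfl⟩ := hg y
    obtain ⟨u, hu⟩ := ha a b
    exact ⟨u, a, b, hu, rfl, rfl⟩

/-! ## Aperiodic homomorphisms -/

/-- A homomorphism is aperiodic if it is injective on subgroups. -/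
def IsAperiodicHom {S T : Type*} [Semigroup S] [Semigroup T] (π : S →ₙ* T) : Prop :=
  ∀ i g g', i * i = i → i * g = g → g * i = g → i * g' = g' → g' * i = g' → g * g' = i →
    g' * g = i → π g = π i → g = i

theorem IsAperiodicHom.comp {S T U : Type*} [Semigroup S] [Semigroup T] [Semigroup U]
    {ρ : T →ₙ* U} {π : S →ₙ* T} (hρ : IsAperiodicHom ρ) (hπ : IsAperiodicHom π) :
    IsAperiodicHom (ρ.comp π) := by
  intro i g g' h1 h2 h3 h4 h5 h6 h7 h8
  refine hπ i g g' h1 h2 h3 h4 h5 h6 h7 (hρ (π i) (π g) (π g') ?_ ?_ ?_ ?_ ?_ ?_ ?_ h8) <;>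
    rw [← map_mul] <;> congr 1

/-- Elements of a subgroup with the same second coordinate share an idempotent one, `w`. At states
fixed by `w` the first coordinates lie in a subgroup of `V.Sgp`, hence are trivial, and multiplying
by the identity of the subgroup spreads this to all states. -/
theorem isAperiodicHom_sndHom {V : TransSgp.{u}} (hV : IsAperiodic V.Sgp) (W : TransSgp.{u}) :
    IsAperiodicHom (sndHom V W) := by
  rintro ⟨p, u⟩ ⟨q, v⟩ ⟨r, w⟩ h1 h2 h3 h4 h5 h6 h7 (rfl : v = u)
  obtain rfl : w = v := (congrArg WreathSgp.snd h5).symm.trans (congrArg WreathSgp.snd h7)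
  have hw : w * w = w := congrArg WreathSgp.snd h1
  have e1 : ∀ s, p s * p (W.act s w) = p s := congrFun (congrArg WreathSgp.fst h1)
  have e2 : ∀ s, p s * q (W.act s w) = q s := congrFun (congrArg WreathSgp.fst h2)
  have e3 : ∀ s, q s * p (W.act s w) = q s := congrFun (congrArg WreathSgp.fst h3)
  have e6 : ∀ s, q s * r (W.act s w) = p s := congrFun (congrArg WreathSgp.fst h6)
  have e7 : ∀ s, r s * q (W.act s w) = p s := congrFun (congrArg WreathSgp.fst h7)
  have hc : ∀ s, W.act (W.act s w) w = W.act s w := fun s => by rw [← W.act_mul, hw]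
  have key : ∀ s, q (W.act s w) = p (W.act s w) := by
    intro s
    have f1 := e1 (W.act s w)
    have f2 := e2 (W.act s w)
    have f3 := e3 (W.act s w)
    have f6 := e6 (W.act s w)
    have f7 := e7 (W.act s w)
    rw [hc] at f1 f2 f3 f6 f7
    exact hV.eq_of_mul f1 f2 f3 f6 f7
  refine WreathSgp.ext (funext fun s => ?_) rfl
  change q s = p s
  rw [← e2 s, key s, e1 s]

/-- An iterated wreath product with at most `m + 1` group factors maps by an aperiodic homomorphism
to the wreath product of a group with an iterated wreath product with at most `m` group factors. -/
theorem IsWreathProduct.exists_isAperiodicHom {n m : ℕ} {W : TransSgp.{u}}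
    (hW : IsWreathProduct n W) (hn : n ≤ m + 1) :
    ∃ (H : Type u) (_ : Group H) (_ : Finite H) (l : ℕ) (V : TransSgp.{u}), l ≤ m ∧
      IsWreathProduct l V ∧ ∃ π : W.Sgp →ₙ* ((ofGroup H).wreath V).Sgp, IsAperiodicHom π := by
  induction hW with
  | trivial =>
    -- No group factor is left, so the trivial group takes its place.
    refine ⟨PUnit, inferInstance, inferInstance, 0, TransSgp.trivial, Nat.zero_le m, .trivial,
      ⟨fun _ => ⟨fun _ => PUnit.unit, PUnit.unit⟩, fun _ _ => rfl⟩, ?_⟩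
    intro _ _ _ _ _ _ _ _ _ _ _
    rfl
  | group n G W hW ih =>
    exact ⟨G, inferInstance, inferInstance, n, W, by omega, hW, MulHom.id _,
      fun _ _ _ _ _ _ _ _ _ _ h => h⟩
  | aperiodic n A W hA hW ih =>
    obtain ⟨H, iG, iF, l, V, hl, hV, π, hπ⟩ := ih hn
    exact ⟨H, iG, iF, l, V, hl, hV, π.comp (sndHom (ofSemigroup A) W),
      hπ.comp (isAperiodicHom_sndHom (V := ofSemigroup A) hA W)⟩

/-- All powers of `a` map to one idempotent, so the cyclic subgroup they eventually form is trivial.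
-/
theorem IsAperiodicHom.exists_pow_eq {S T : Type*} [Semigroup S] [Finite S] [Semigroup T]
    {π : S →ₙ* T} (hπ : IsAperiodicHom π) (a : S) (ha : π a * π a = π a) :
    ∃ n, (a : WithOne S) ^ n = (a : WithOne S) ^ (n + 1) := by
  have : Finite (WithOne S) := inferInstanceAs (Finite (Option S))
  have hpow : ∀ n, ∃ b : S, (a : WithOne S) ^ (n + 1) = b ∧ π b = π a := by
    intro n
    induction n with
    | zero => exact ⟨a, by simp, rfl⟩
    | succ n ih =>
      obtain ⟨b, hb, hb'⟩ := ih
      exact ⟨b * a, by rw [pow_succ, hb, WithOne.coe_mul], by rw [map_mul, hb', ha]⟩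
  obtain ⟨n, hn, hi⟩ := exists_pow_idempotent (a : WithOne S)
  obtain ⟨n, rfl⟩ := Nat.exists_eq_succ_of_ne_zero hn.ne'
  have hk : ∀ k, (a : WithOne S) ^ (n + 1) * (a : WithOne S) ^ (n + 1 + k) =
      (a : WithOne S) ^ (n + 1 + k) := fun k => by
    rw [pow_add _ (n + 1), ← mul_assoc, hi]
  have hk' : ∀ k, (a : WithOne S) ^ (n + 1 + k) * (a : WithOne S) ^ (n + 1) =
      (a : WithOne S) ^ (n + 1 + k) := fun k => by
    rw [← pow_add, add_comm, pow_add _ (n + 1), hk]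
  -- With $i=a^{n+1}$ idempotent, take $g=a^{n+2}$ and its inverse $g'=a^{2n+1}$, since
  -- $gg'=(a^{n+1})^3=i$.
  obtain ⟨i, hi', hπi⟩ := hpow n
  obtain ⟨g, hg, hπg⟩ := hpow (n + 1)
  obtain ⟨g', hg', -⟩ := hpow (n + n)
  have h0 := hk 0
  have h1 := hk 1
  have h2 := hk' 1
  have h3 := hk n
  have h4 := hk' n
  have h5 : (a : WithOne S) ^ (n + 1 + 1) * (a : WithOne S) ^ (n + n + 1) =
      (a : WithOne S) ^ (n + 1) := by
    rw [← pow_add, show n + 1 + 1 + (n + n + 1) = (n + 1) + (n + 1) + (n + 1) by ring, pow_add,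
      pow_add, hi, hi]
  have h6 : (a : WithOne S) ^ (n + n + 1) * (a : WithOne S) ^ (n + 1 + 1) =
      (a : WithOne S) ^ (n + 1) := by rw [← pow_add, add_comm, pow_add, h5]
  rw [show n + 1 + n = n + n + 1 by ring] at h3 h4
  rw [add_zero] at h0
  rw [hi'] at h0 h1 h2 h3 h4 h5 h6
  rw [hg] at h1 h2 h5 h6
  rw [hg'] at h3 h4 h5 h6
  norm_cast at h0 h1 h2 h3 h4 h5 h6
  have := hπ i g g' h0 h1 h2 h3 h4 h5 h6 (hπg.trans hπi.symm)
  exact ⟨n + 1, by rw [hi', hg, this]⟩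

theorem exists_perm_extending {α I : Type*} [Finite α] (a b : I → α)
    (h : ∀ i j, a i = a j ↔ b i = b j) : ∃ σ : Equiv.Perm α, ∀ i, σ (a i) = b i := by
  classical
  have := Fintype.ofFinite α
  let ψ : Set.range a → Set.range b := fun x => ⟨b x.2.choose, _, rfl⟩
  have hψ : ∀ i, ψ ⟨a i, i, rfl⟩ = ⟨b i, i, rfl⟩ := fun i =>
    Subtype.ext ((h _ _).1 (Exists.choose_spec (⟨i, rfl⟩ : a i ∈ Set.range a)))
  have hb : Function.Bijective ψ := by
    constructor
    · rintro ⟨_, i, rfl⟩ ⟨_, j, rfl⟩ hij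
      rw [hψ, hψ] at hij
      exact Subtype.ext ((h i j).2 (congrArg Subtype.val hij))
    · rintro ⟨_, i, rfl⟩
      exact ⟨_, hψ i⟩
  let ε : { x // x ∈ Set.range a } ≃ { x // x ∈ Set.range b } := Equiv.ofBijective ψ hb
  exact ⟨ε.extendSubtype, fun i => (ε.extendSubtype_apply_of_mem (a i) ⟨i, rfl⟩).trans
    (congrArg Subtype.val (hψ i))⟩

/-! ## The maximal subgroup and its `ℛ`-class -/

section RClass

variable {S : Type u} [Semigroup S] {e : S} {he : IsIdempotentElem e}

theorem MaxSubgroup.elt_one : (1 : MaxSubgroup he).elt = e := rfl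

theorem MaxSubgroup.elt_mul (g h : MaxSubgroup he) : (g * h).elt = g.elt * h.elt := rfl

theorem MaxSubgroup.elt_injective : Function.Injective (MaxSubgroup.elt (he := he)) :=
  fun _ _ h => Units.ext (LocalMonoid.ext h)

theorem MaxSubgroup.mul_elt (g : MaxSubgroup he) : e * g.elt = g.elt := g.val.left_mul

theorem MaxSubgroup.elt_mul_idem (g : MaxSubgroup he) : g.elt * e = g.elt := g.val.right_mul

theorem MaxSubgroup.elt_mul_inv (g : MaxSubgroup he) : g.elt * (g⁻¹).elt = e := by
  rw [← elt_mul, mul_inv_cancel, elt_one]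

theorem MaxSubgroup.inv_elt_mul (g : MaxSubgroup he) : (g⁻¹).elt * g.elt = e := by
  rw [← elt_mul, inv_mul_cancel, elt_one]

instance [Finite S] : Finite (LocalMonoid he) :=
  Finite.of_injective LocalMonoid.val fun _ _ => LocalMonoid.ext

theorem mem_rClass_iff (he : IsIdempotentElem e) {y : S} :
    y ∈ RClass e ↔ e * y = y ∧ ∃ t, y * t = e := by
  constructor
  · rintro ⟨⟨a, ha⟩, ⟨b, hb⟩⟩
    refine ⟨WithOne.coe_inj.1 ?_, ?_⟩
    · rw [WithOne.coe_mul, ha, ← mul_assoc, ← WithOne.coe_mul, he.eq]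
    · obtain rfl | ⟨b, rfl⟩ := eq_one_or_coe b
      · rw [mul_one] at hb
        rw [← WithOne.coe_inj.1 hb]
        exact ⟨e, he⟩
      · exact ⟨b, WithOne.coe_inj.1 hb.symm⟩
  · rintro ⟨h, t, ht⟩
    exact ⟨⟨y, by rw [← WithOne.coe_mul, h]⟩, ⟨t, by rw [← WithOne.coe_mul, ht]⟩⟩

theorem MaxSubgroup.elt_mem_rClass (g : MaxSubgroup he) : g.elt ∈ RClass e :=
  (mem_rClass_iff he).2 ⟨g.mul_elt, _, g.elt_mul_inv⟩

theorem MaxSubgroup.elt_mul_mem_rClass (g : MaxSubgroup he) {y : S} (hy : y ∈ RClass e) :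
    g.elt * y ∈ RClass e := by
  obtain ⟨h, t, ht⟩ := (mem_rClass_iff he).1 hy
  refine (mem_rClass_iff he).2 ⟨by rw [← mul_assoc, g.mul_elt], t * (g⁻¹).elt, ?_⟩
  rw [mul_assoc, ← mul_assoc y, ht, mul_elt, elt_mul_inv]

theorem mem_rClass_of_mul_mem (he : IsIdempotentElem e) {y s : S} (hy : y ∈ RClass e) {t : S}
    (h : y * (s * t) ∈ RClass e) : y * s ∈ RClass e := by
  obtain ⟨h1, -⟩ := (mem_rClass_iff he).1 hy
  obtain ⟨-, r, hr⟩ := (mem_rClass_iff he).1 h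
  exact (mem_rClass_iff he).2 ⟨by rw [← mul_assoc, h1], t * r, by simpa only [mul_assoc] using hr⟩

end RClass

/-! ## Flows bound pointlike sets -/

/-- From the base point, the state of `V` reached determines through `β` the transformation of the
automaton given by the word read. Thus a further group factor may depend on the current automaton
state. -/
theorem ComplexityLe.exists_tracking {k : ℕ} {X : Type u} {A : Automaton X}
    (h : ComplexityLe k A.Sgp) :
    ∃ (n : ℕ) (V : TransSgp.{u}), n ≤ k ∧ IsWreathProduct n V ∧ ∃ (D : Set V.State)
      (β : V.State → (Function.End (Option A.State))ᵐᵒᵖ) (lift : X → V.Sgp),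
      (∃ p ∈ D, β p = 1) ∧ ∀ p ∈ D, ∀ x, V.act p (lift x) ∈ D ∧
        β (V.act p (lift x)) = β p * A.letter x := by
  classical
  obtain ⟨n, W, hn, hW, U, φ, hφ⟩ := h
  obtain ⟨V, hV, D, θ, lift, ⟨p₀, hp₀, hθ₀⟩, h⟩ := hW.exists_tracking
  have hx : ∀ x, ∃ u : U, (φ u : (Function.End (Option A.State))ᵐᵒᵖ) = A.letter x := fun x => by
    obtain ⟨u, hu⟩ := hφ ⟨A.letter x, Subsemigroup.subset_closure ⟨x, rfl⟩⟩
    exact ⟨u, congrArg Subtype.val hu⟩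
  choose w hw using hx
  -- Outside `U` the value `1` is arbitrary: the new `D` keeps only states whose value is `1` or
  -- lies in `U`.
  let γ : WithOne W.Sgp → (Function.End (Option A.State))ᵐᵒᵖ := fun s =>
    WithOne.recOneCoe 1 (fun u => if hu : u ∈ U then (φ ⟨u, hu⟩ : _) else 1) s
  have hγ : ∀ u : U, γ ((u : W.Sgp) : WithOne W.Sgp) = φ u := fun u => dif_pos u.2
  refine ⟨n, V, hn, hV, {p ∈ D | θ p = 1 ∨ ∃ u : U, θ p = ((u : W.Sgp) : WithOne W.Sgp)},
    fun p => γ (θ p), fun x => lift (w x), ⟨p₀, ⟨hp₀, Or.inl hθ₀⟩, by simp only [hθ₀]; rfl⟩, ?_⟩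
  rintro p ⟨hp, hθ⟩ x
  obtain ⟨h1, h2⟩ := h p hp (w x)
  rcases hθ with hθ | ⟨u, hθ⟩
  · rw [hθ, one_mul] at h2
    refine ⟨⟨h1, Or.inr ⟨w x, h2⟩⟩, ?_⟩
    change γ (θ _) = γ (θ p) * _
    rw [h2, hγ, hw, hθ]
    exact (one_mul _).symm
  · rw [hθ, ← WithOne.coe_mul] at h2
    have h2 : θ (V.act p (lift (w x))) = ((u * w x : U) : W.Sgp) := h2
    refine ⟨⟨h1, Or.inr ⟨_, h2⟩⟩, ?_⟩
    change γ (θ _) = γ (θ p) * _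
    rw [h2, hγ, hθ, hγ, ← hw, map_mul]
    rfl

/-- The class of an element under a set-partition. -/
def SetPartition.cls {α : Type u} (P : SetPartition α) (y : α) : Set α := {z | P.rel y z}

theorem SetPartition.cls_eq_iff {α : Type u} (P : SetPartition α) {y z : α} (hz : z ∈ P.carrier) :
    P.cls y = P.cls z ↔ P.rel y z := by
  constructor
  · intro h
    have : z ∈ P.cls z := hz
    rwa [← h] at this
  · intro h
    ext x
    exact ⟨P.trans _ _ _ (P.symm _ _ h), P.trans _ _ _ h⟩

/-- The flow yields a relational morphism into `(ofGroup H).wreath V`, with one group factor more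
than `V`, under which distinct group elements have no common image. -/
theorem AdmitsFlow.subsingleton_of_isPointlike {M : Type u} [Semigroup M] [Finite M] {e : M}
    {he : IsIdempotentElem e} {X : Type u} {ι : X → M}
    (hι : Subsemigroup.closure (Set.range ι) = ⊤) {k : ℕ} (h : AdmitsFlow he ι k)
    {Z : Set (MaxSubgroup he)} (hZ : IsPointlike (k + 1) {s : M | ∃ g ∈ Z, s = g.elt}) :
    Z.Subsingleton := by
  obtain ⟨A, hA, f, ⟨hflow, hcomp, hcover⟩, -⟩ := h
  obtain ⟨n, V, hn, hV, D, β, lift, ⟨p₀, hp₀, hβ₀⟩, htrack⟩ := hA.exists_tracking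
  obtain ⟨_, _⟩ := hV.finite
  let F : Option A.State → SetPartition (RClass e) := fun q => q.elim (SetPartition.bottom _) f
  have hmap : ∀ q x (y z : RClass e), y ∈ (F q).carrier → (z : M) = y * ι x →
      z ∈ (F ((A.letter x).unop q)).carrier := fun q x => hcomp.mapsTo q x _ rfl
  -- The permutation goes backwards, from the class after the letter to the class before it, since
  -- permutations compose from right to left while words are read from left to right.
  have hperm : ∀ q x, ∃ σ : Equiv.Perm (Set (RClass e)), ∀ y z : RClass e, y ∈ (F q).carrier →
      (z : M) = y * ι x → σ ((F ((A.letter x).unop q)).cls z) = (F q).cls y := by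
    intro q x
    obtain ⟨σ, hσ⟩ := exists_perm_extending
      (I := {yz : RClass e × RClass e // yz.1 ∈ (F q).carrier ∧ (yz.2 : M) = yz.1 * ι x})
      (fun i => (F ((A.letter x).unop q)).cls i.1.2) (fun i => (F q).cls i.1.1) (by
        rintro ⟨⟨y, z⟩, hy, hz⟩ ⟨⟨y', z'⟩, hy', hz'⟩
        rw [SetPartition.cls_eq_iff _ (hmap q x _ _ hy' hz'), SetPartition.cls_eq_iff _ hy']
        exact (hcomp.injective q x _ rfl y y' z z' hy hy' hz hz').symm)
    exact ⟨σ, fun y z hy hz => hσ ⟨(y, z), hy, hz⟩⟩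
  choose σ hσ using hperm
  -- One permutation for every possible starting state, all recorded simultaneously.
  let H := Option A.State → Equiv.Perm (Set (RClass e))
  have : Finite (ofGroup H).Sgp := inferInstanceAs (Finite H)
  let T := WreathSgp (ofGroup H) V
  let t : X → T := fun x => ⟨fun p => fun q => σ ((β p).unop q) x, lift x⟩
  -- The third coordinate is the automaton transformation. At `p₀`, where `β` is `1`, it is
  -- determined by the wreath coordinate, so it need not be part of the target.
  let E : Subsemigroup (M × (T × (Function.End (Option A.State))ᵐᵒᵖ)) :=
    Subsemigroup.closure (Set.range fun x => (ι x, (t x, A.letter x)))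
  have hE : ∀ z ∈ E, ∀ p ∈ D, V.act p z.2.1.snd ∈ D ∧ β (V.act p z.2.1.snd) = β p * z.2.2 ∧
      ∀ q, ∀ y ∈ (F ((β p).unop q)).carrier, ∀ y' : RClass e, (y' : M) = y * z.1 →
        y' ∈ (F (z.2.2.unop ((β p).unop q))).carrier ∧
        (z.2.1.fst p : H) q ((F (z.2.2.unop ((β p).unop q))).cls y') =
          (F ((β p).unop q)).cls y := by
    intro z hz
    induction hz using Subsemigroup.closure_induction with
    | mem z hz =>
      obtain ⟨x, rfl⟩ := hz
      intro p hp
      obtain ⟨h1, h2⟩ := htrack p hp x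
      exact ⟨h1, h2, fun q y hy y' hy' => ⟨hmap _ x y y' hy hy', hσ _ x y y' hy hy'⟩⟩
    | mul z w _ _ hz hw =>
      intro p hp
      obtain ⟨h1, h2, h3⟩ := hz p hp
      obtain ⟨h4, h5, h6⟩ := hw _ h1
      have hact : V.act p (z * w).2.1.snd = V.act (V.act p z.2.1.snd) w.2.1.snd := V.act_mul _ _ _
      rw [hact]
      refine ⟨h4, by rw [h5, h2, mul_assoc]; rfl, fun q y hy y' hy' => ?_⟩
      have hmem : (y : M) * z.1 ∈ RClass e :=
        mem_rClass_of_mul_mem he y.2 (t := w.1) (by rw [← Prod.fst_mul, ← hy']; exact y'.2)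
      obtain ⟨h7, h8⟩ := h3 q y hy ⟨_, hmem⟩ rfl
      rw [h2] at h6
      obtain ⟨h9, h10⟩ := h6 q ⟨_, hmem⟩ h7 y' (by rw [hy', Prod.fst_mul, mul_assoc])
      exact ⟨h9, (congrArg ((z.2.1.fst p : H) q) h10).trans h8⟩
  have htotal : ∀ m : M, ∃ t c, (m, (t, c)) ∈ E := by
    intro m
    have hm : m ∈ Subsemigroup.closure (Set.range ι) := hι ▸ Subsemigroup.mem_top m
    induction hm using Subsemigroup.closure_induction with
    | mem m hm =>
      obtain ⟨x, rfl⟩ := hm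
      exact ⟨_, _, Subsemigroup.subset_closure ⟨x, rfl⟩⟩
    | mul m m' _ _ h h' =>
      obtain ⟨t, c, h⟩ := h
      obtain ⟨t', c', h'⟩ := h'
      exact ⟨t * t', c * c', E.mul_mem h h'⟩
  obtain ⟨t, ht⟩ := hZ T ⟨n + 1, (ofGroup H).wreath V, by omega, hV.group n H V, Divides.refl _⟩
    ⟨fun m t => ∃ c, (m, (t, c)) ∈ E, htotal, by
      rintro m t m' t' ⟨c, h⟩ ⟨c', h'⟩
      exact ⟨c * c', E.mul_mem h h'⟩⟩
  -- Start at a state whose carrier contains `e`. The permutation of the common image `t` sends the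
  -- class of `g` and that of `g'` both to the class of `e`.
  obtain ⟨q, hq⟩ := hcover ⟨e, (1 : MaxSubgroup he).elt_mem_rClass⟩
  intro g hg g' hg'
  obtain ⟨c, hc⟩ := ht _ ⟨g, hg, rfl⟩
  obtain ⟨c', hc'⟩ := ht _ ⟨g', hg', rfl⟩
  obtain ⟨-, h2, h3⟩ := hE _ hc p₀ hp₀
  obtain ⟨-, h2', h3'⟩ := hE _ hc' p₀ hp₀
  rw [hβ₀, one_mul] at h2 h2'
  obtain rfl : c = c' := h2.symm.trans h2'
  rw [hβ₀] at h3 h3'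
  obtain ⟨h4, h5⟩ := h3 (some q) _ hq ⟨g.elt, g.elt_mem_rClass⟩ g.mul_elt.symm
  obtain ⟨h4', h5'⟩ := h3' (some q) _ hq ⟨g'.elt, g'.elt_mem_rClass⟩ g'.mul_elt.symm
  have hcls := Equiv.injective _ (h5.trans h5'.symm)
  rw [SetPartition.cls_eq_iff _ h4'] at hcls
  have := hcomp.crossSection _ _ _ hcls ⟨g' * g⁻¹, by
    rw [MaxSubgroup.elt_mul, mul_assoc, MaxSubgroup.inv_elt_mul, MaxSubgroup.elt_mul_idem]⟩
  exact MaxSubgroup.elt_injective (congrArg Subtype.val this)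

/-! ## Flows from relational morphisms -/

theorem exists_relMorphism_of_not_isPointlike {k : ℕ} {M : Type u} [Semigroup M]
    {Zs : Set (Set M)} (hfin : Zs.Finite) (h : ∀ Z ∈ Zs, ¬ IsPointlike k Z) :
    ∃ (T : Type u) (_ : Semigroup T) (_ : Finite T), ComplexityLe k T ∧
      ∃ r : RelMorphism M T, ∀ Z ∈ Zs, ¬ ∃ t, ∀ s ∈ Z, r.rel s t := by
  induction Zs, hfin using Set.Finite.induction_on with
  | empty =>
    exact ⟨PUnit, inferInstance, inferInstance, .punit k,
      ⟨fun _ _ => True, fun _ => ⟨PUnit.unit, trivial⟩, fun _ _ _ _ _ _ => trivial⟩,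
      fun _ h => h.elim⟩
  | @insert Z Zs _ _ ih =>
    obtain ⟨T, iT, fT, hT, r, hr⟩ := ih fun Z hZ => h Z (Or.inr hZ)
    have hZ := h Z (Or.inl rfl)
    unfold IsPointlike at hZ
    push Not at hZ
    obtain ⟨T', iT', fT', hT', r', hr'⟩ := hZ
    refine ⟨T × T', inferInstance, inferInstance, hT.prod hT',
      ⟨fun s t => r.rel s t.1 ∧ r'.rel s t.2, fun s => ?_, fun s t s' t' h h' =>
        ⟨r.mul _ _ _ _ h.1 h'.1, r'.mul _ _ _ _ h.2 h'.2⟩⟩, ?_⟩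
    · obtain ⟨t, ht⟩ := r.total s
      obtain ⟨t', ht'⟩ := r'.total s
      exact ⟨(t, t'), ht, ht'⟩
    · rintro Y (rfl | hY) ⟨t, ht⟩
      · obtain ⟨s, hs, hs'⟩ := hr' t.2
        exact hs' (ht s hs).2
      · exact hr Y hY ⟨t.1, fun s hs => (ht s hs).1⟩

theorem mem_closure_graph {M T X : Type*} [Semigroup M] [Semigroup T] {ι : X → M}
    (hι : Subsemigroup.closure (Set.range ι) = ⊤) (v : X → T) (m : M) :
    ∃ t, (m, t) ∈ Subsemigroup.closure (Set.range fun x => (ι x, v x)) := by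
  have hm : m ∈ Subsemigroup.closure (Set.range ι) := hι ▸ Subsemigroup.mem_top m
  induction hm using Subsemigroup.closure_induction with
  | mem m hm =>
    obtain ⟨x, rfl⟩ := hm
    exact ⟨_, Subsemigroup.subset_closure ⟨x, rfl⟩⟩
  | mul m m' _ _ h h' =>
    obtain ⟨t, h⟩ := h
    obtain ⟨t', h'⟩ := h'
    exact ⟨t * t', Subsemigroup.mul_mem _ h h'⟩

/-- A morphism that makes no non-trivial subgroup pointlike is composed with an aperiodic
homomorphism onto a semigroup of the form $H\wr V$. The composite still separates over idempotents:
a subgroup over an idempotent `f` is related to the aperiodic fibre of `f`, so it would have a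
common image one level up. -/
theorem exists_graph_separating {M : Type u} [Semigroup M] [Finite M] {e : M}
    (he : IsIdempotentElem e) {X : Type u} {ι : X → M} {k : ℕ}
    (h : ∀ P : Subgroup (MaxSubgroup he),
      IsPointlike (k + 1) {s : M | ∃ g ∈ P, s = g.elt} → P = ⊥) :
    ∃ (H : Type u) (_ : Group H) (_ : Finite H) (l : ℕ) (V : TransSgp.{u}) (_ : l ≤ k)
      (_ : IsWreathProduct l V) (v : X → WreathSgp (ofGroup H) V),
      ∀ f, f * f = f → ∀ P : Subgroup (MaxSubgroup he),
        (∀ g ∈ P, (g.elt, f) ∈ Subsemigroup.closure (Set.range fun x => (ι x, v x))) →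
        P = ⊥ := by
  obtain ⟨T, _, _, ⟨n, W, hn, hW, U, φ, hφ⟩, r, hr⟩ := exists_relMorphism_of_not_isPointlike
    (k := k + 1) (Zs := {Z | ∃ P : Subgroup (MaxSubgroup he), P ≠ ⊥ ∧
      Z = {s : M | ∃ g ∈ P, s = g.elt}}) (Set.toFinite _) (by
      rintro _ ⟨P, hP, rfl⟩ hp
      exact hP (h P hp))
  obtain ⟨_, _⟩ := hW.finite
  obtain ⟨H, iH, fH, l, V, hl, hV, π, hπ⟩ := hW.exists_isAperiodicHom hn
  choose t ht using fun x => r.total (ι x)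
  choose u hu using fun x => hφ (t x)
  refine ⟨H, iH, fH, l, V, hl, hV, fun x => π (u x), fun f hf P hP => ?_⟩
  by_contra hne
  let E : Subsemigroup (M × W.Sgp) :=
    Subsemigroup.closure (Set.range fun x => (ι x, (u x : W.Sgp)))
  have hE : ∀ z ∈ E, ∃ h : z.2 ∈ U, r.rel z.1 (φ ⟨z.2, h⟩) := by
    intro z hz
    induction hz using Subsemigroup.closure_induction with
    | mem z hz =>
      obtain ⟨x, rfl⟩ := hz
      exact ⟨(u x).2, (hu x).symm ▸ ht x⟩
    | mul z w _ _ hz hw =>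
      obtain ⟨h1, h2⟩ := hz
      obtain ⟨h3, h4⟩ := hw
      have := r.mul _ _ _ _ h2 h4
      rw [← map_mul] at this
      exact ⟨U.mul_mem h1 h3, this⟩
  have hlift : ∀ z ∈ Subsemigroup.closure (Set.range fun x => (ι x, π (u x))),
      ∃ a, (z.1, a) ∈ E ∧ π a = z.2 := by
    intro z hz
    induction hz using Subsemigroup.closure_induction with
    | mem z hz =>
      obtain ⟨x, rfl⟩ := hz
      exact ⟨u x, Subsemigroup.subset_closure ⟨x, rfl⟩, rfl⟩
    | mul z w _ _ hz hw =>
      obtain ⟨a, h1, h2⟩ := hz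
      obtain ⟨b, h3, h4⟩ := hw
      exact ⟨a * b, E.mul_mem h1 h3, by rw [map_mul, h2, h4]; rfl⟩
  -- Elements over the idempotent `f` are aperiodic, so all of `P` is related to a single one of
  -- them.
  obtain ⟨c, hc⟩ := exists_forall_rel_of_aperiodic (P := P)
    (fun g (c : WithOne W.Sgp) => ∃ a : W.Sgp, c = a ∧ ((g : MaxSubgroup he).elt, a) ∈ E ∧ π a = f)
    (by
      rintro g _ g' _ ⟨a, rfl, h1, h2⟩ ⟨a', rfl, h1', h2'⟩
      exact ⟨a * a', (WithOne.coe_mul _ _).symm, E.mul_mem h1 h1', by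
        rw [map_mul, h2, h2']
        exact hf⟩)
    (by
      intro g
      obtain ⟨a, h1, h2⟩ := hlift _ (hP g g.2)
      exact ⟨a, a, rfl, h1, h2⟩)
    (by
      rintro g _ ⟨a, rfl, -, h2⟩
      exact hπ.exists_pow_eq a (by
        rw [h2]
        exact hf))
  obtain ⟨a, rfl, ha, -⟩ := hc 1
  obtain ⟨haU, -⟩ := hE _ ha
  refine hr _ ⟨P, hne, rfl⟩ ⟨φ ⟨a, haU⟩, ?_⟩
  rintro _ ⟨g, hg, rfl⟩
  obtain ⟨b, hb, hgb, -⟩ := hc ⟨g, hg⟩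
  obtain rfl := WithOne.coe_inj.1 hb
  exact (hE _ hgb).2

/-- An element of the wreath product of a group with a transformation semigroup. -/
def wreathMk {H : Type u} [Group H] {V : TransSgp.{u}} (h : V.State → H) (w : V.Sgp) :
    WreathSgp (ofGroup H) V := ⟨h, w⟩

theorem wreathMk_mul {H : Type u} [Group H] {V : TransSgp.{u}} (h h' : V.State → H)
    (w w' : V.Sgp) :
    wreathMk h w * wreathMk h' w' = wreathMk (fun q => h q * h' (V.act q w)) (w * w') := rfl

theorem wreathMk_inj {H : Type u} [Group H] {V : TransSgp.{u}} {h h' : V.State → H}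
    {w w' : V.Sgp} : wreathMk h w = wreathMk h' w' ↔ h = h' ∧ w = w' := by
  constructor
  · intro hh
    exact ⟨congrArg WreathSgp.fst hh, congrArg WreathSgp.snd hh⟩
  · rintro ⟨rfl, rfl⟩
    rfl

theorem wreathMk_surj {H : Type u} [Group H] {V : TransSgp.{u}} (v : WreathSgp (ofGroup H) V) :
    ∃ (h : V.State → H) (w : V.Sgp), v = wreathMk h w := ⟨v.fst, v.snd, rfl⟩

theorem MaxSubgroup.mul_inv_elt_mul {M : Type u} [Semigroup M] {e : M} {he : IsIdempotentElem e}
    (g g' : MaxSubgroup he) (y : M) : (g * g'⁻¹).elt * (g'.elt * y) = g.elt * y := by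
  rw [elt_mul, mul_assoc, ← mul_assoc _ g'.elt, inv_elt_mul, ← mul_assoc, elt_mul_idem]

/-- Right multiplication is a homomorphism from `V.Sgp` to partial functions on `V.Sgp` whose image
contains the semigroup of the automaton. -/
theorem complexityLe_sgp_of_mul {k : ℕ} {X : Type u} {V : TransSgp.{u}} [Finite V.Sgp]
    {l : ℕ} (hl : l ≤ k) (hV : IsWreathProduct l V) (w : X → V.Sgp) :
    ComplexityLe k (Automaton.mk V.Sgp fun s x => some (s * w x)).Sgp := by
  set A := Automaton.mk V.Sgp fun s x => some (s * w x) with hA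
  let Φ : V.Sgp →ₙ* (Function.End (Option V.Sgp))ᵐᵒᵖ :=
    { toFun := fun u => MulOpposite.op fun q => q.map (· * u)
      map_mul' := fun u u' => by
        refine MulOpposite.unop_injective (funext fun q => ?_)
        change Option.map _ q = Option.map _ (Option.map _ q)
        rw [Option.map_map]
        congr 1
        funext s
        exact (mul_assoc s u u').symm }
  have hΦ : ∀ x, A.letter x = Φ (w x) := fun x =>
    MulOpposite.unop_injective (funext fun q => by cases q <;> rfl)
  refine ⟨l, V, hl, hV, Divides.of_rel (fun u (c : A.Sgp) => Φ u = c) ?_ ?_ ?_⟩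
  · intro u c u' c' h h'
    rw [map_mul, h, h']
    rfl
  · intro u c c' h h'
    exact Subtype.ext (h.symm.trans h')
  · rintro ⟨c, hc⟩
    induction hc using Subsemigroup.closure_induction with
    | mem c hc =>
      obtain ⟨x, rfl⟩ := hc
      exact ⟨w x, (hΦ x).symm⟩
    | mul c c' _ _ h h' =>
      obtain ⟨u, hu⟩ := h
      obtain ⟨u', hu'⟩ := h'
      exact ⟨u * u', by rw [map_mul, hu, hu']⟩

theorem admitsFlow_of_pointlike_trivial {M : Type u} [Semigroup M] [Finite M] {e : M}
    (he : IsIdempotentElem e) {X : Type u} {ι : X → M}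
    (hι : Subsemigroup.closure (Set.range ι) = ⊤) {k : ℕ}
    (h : ∀ P : Subgroup (MaxSubgroup he),
      IsPointlike (k + 1) {s : M | ∃ g ∈ P, s = g.elt} → P = ⊥) :
    AdmitsFlow he ι k := by
  obtain ⟨H, _, _, l, V, hl, hV, v, hsep⟩ := exists_graph_separating he (ι := ι) h
  obtain ⟨_, _⟩ := hV.finite
  have : Finite (ofGroup H).Sgp := inferInstanceAs (Finite H)
  have htotal := mem_closure_graph hι v
  have hgen : ∀ x, (ι x, v x) ∈ Subsemigroup.closure (Set.range fun x => (ι x, v x)) :=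
    fun x => Subsemigroup.subset_closure ⟨x, rfl⟩
  generalize Subsemigroup.closure (Set.range fun x => (ι x, v x)) = E at hsep htotal hgen
  -- Minimality of `f` over `e` makes every pair in `R` returnable to `(e, f)` by right
  -- multiplication, which is `ret`. All partition properties below rest on this.
  obtain ⟨f, hfE, hff, hmin⟩ := exists_idempotent_minimal_right {f | (e, f) ∈ E} (htotal e)
    fun a ha b hb => by
      have := E.mul_mem ha hb
      rwa [Prod.mk_mul_mk, he.eq] at this
  change (e, f) ∈ E at hfE
  have heR : e ∈ RClass e := (1 : MaxSubgroup he).elt_mem_rClass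
  let R : M → WreathSgp (ofGroup H) V → Prop := fun y v => y ∈ RClass e ∧ (y, v) ∈ E ∧ f * v = v
  have hR1 : R e f := ⟨heR, hfE, hff⟩
  have fwd : ∀ y v s σ, R y v → (s, σ) ∈ E → y * s ∈ RClass e → R (y * s) (v * σ) := by
    rintro y v s σ ⟨-, h2, h3⟩ hs hys
    exact ⟨hys, E.mul_mem h2 hs, by rw [← mul_assoc, h3]⟩
  have ret : ∀ y v, R y v → ∃ t τ, (t, τ) ∈ E ∧ y * t = e ∧ v * τ = f := by
    rintro y v ⟨h1, h2, h3⟩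
    obtain ⟨-, t, ht⟩ := (mem_rClass_iff he).1 h1
    obtain ⟨τ, hτ⟩ := htotal t
    obtain ⟨b, hb, hb'⟩ := hmin (v * τ) (by
      have := E.mul_mem h2 hτ
      rwa [Prod.mk_mul_mk, ht] at this) (by rw [← mul_assoc, h3])
    exact ⟨t * e, τ * b, E.mul_mem hτ hb, by rw [← mul_assoc, ht, he.eq],
      by rw [← mul_assoc, hb']⟩
  -- A ternary operation $h h_1^{-1}h_2$: return from `y` to `(e, f)` along a path that takes `a.elt
  -- * y` to `a.elt`, then multiply by the pair of `y'`.
  have tern : ∀ (a : MaxSubgroup he) (y y' : M) (h h₁ h₂ : V.State → H) (w w' : V.Sgp),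
      R (a.elt * y) (wreathMk h w) → R y (wreathMk h₁ w) → R y' (wreathMk h₂ w') →
      R (a.elt * y') (wreathMk (fun q => h q * (h₁ q)⁻¹ * h₂ q) w') := by
    rintro a y y' h h₁ h₂ w w' ⟨-, h2, h3⟩ hy ⟨h4, h5, h6⟩
    obtain ⟨t, τ, hτ, ht, hτf⟩ := ret _ _ hy
    obtain ⟨b, u, rfl⟩ := wreathMk_surj τ
    have hmem := E.mul_mem (E.mul_mem h2 hτ) h5
    have heq : wreathMk h w * wreathMk b u * wreathMk h₂ w' =
        wreathMk (fun q => h q * (h₁ q)⁻¹ * h₂ q) w' := by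
      rw [← hτf, wreathMk_mul, wreathMk_mul, wreathMk_inj] at h6
      rw [wreathMk_mul, wreathMk_mul, wreathMk_inj]
      refine ⟨funext fun q => ?_, h6.2⟩
      rw [← congrFun h6.1 q]
      group
    simp only [Prod.mk_mul_mk] at hmem
    rw [mul_assoc a.elt, ht, MaxSubgroup.elt_mul_idem, heq] at hmem
    refine ⟨a.elt_mul_mem_rClass h4, hmem, ?_⟩
    rw [← heq, ← mul_assoc, ← mul_assoc, h3]
  have tern' : ∀ (g g' : MaxSubgroup he) (z z' : M) (h h₁ h₂ : V.State → H) (w w' : V.Sgp),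
      R (g.elt * z) (wreathMk h w) → R (g'.elt * z) (wreathMk h₁ w) →
      R (g'.elt * z') (wreathMk h₂ w') →
      R (g.elt * z') (wreathMk (fun q => h q * (h₁ q)⁻¹ * h₂ q) w') := by
    intro g g' z z' h h₁ h₂ w w' h1 h2 h3
    have := tern (g * g'⁻¹) (g'.elt * z) (g'.elt * z') h h₁ h₂ w w'
      (by rwa [MaxSubgroup.mul_inv_elt_mul]) h2 h3
    rwa [MaxSubgroup.mul_inv_elt_mul] at this
  let η : X → V.State → H := fun x => (v x).fst
  -- States are the elements of `V.Sgp`, so a state is the whole second coordinate of a pair in `R`.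
  let A : Automaton X := ⟨V.Sgp, fun s x => some (s * (v x).snd)⟩
  let F : V.Sgp → SetPartition (RClass e) := fun w =>
    { rel := fun z z' => ∃ (g : MaxSubgroup he) (h : V.State → H),
        R (g.elt * z) (wreathMk h w) ∧ R (g.elt * z') (wreathMk h w)
      symm := by
        rintro z z' ⟨g, h, h1, h2⟩
        exact ⟨g, h, h2, h1⟩
      trans := by
        rintro z z' z'' ⟨g, h, h1, h2⟩ ⟨g', h', h3, h4⟩
        refine ⟨g, h, h1, ?_⟩
        have := tern' g g' z' z'' h h' h' w w h2 h3 h4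
        simpa only [inv_mul_cancel_right] using this }
  have step : ∀ (g : MaxSubgroup he) (z : RClass e) (h : V.State → H) (w : V.Sgp) (x : X)
      (z' : RClass e), (z' : M) = z * ι x → R (g.elt * z) (wreathMk h w) →
      R (g.elt * z') (wreathMk (fun q => h q * η x (V.act q w)) (w * (v x).snd)) := by
    intro g z h w x z' hz' hz
    rw [hz', ← mul_assoc]
    refine fwd _ _ _ _ hz (hgen x) ?_
    rw [mul_assoc, ← hz']
    exact g.elt_mul_mem_rClass z'.2
  have mapsTo : ∀ w x, ∀ y z : RClass e, y ∈ (F w).carrier → (z : M) = y * ι x →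
      z ∈ (F (w * (v x).snd)).carrier := by
    rintro w x y z ⟨g, h, h1, -⟩ hz
    exact ⟨g, _, step _ _ _ _ _ _ hz h1, step _ _ _ _ _ _ hz h1⟩
  -- `y` already has some witness at `w`. Comparing it with its image after `x` lets `tern'` undo
  -- the letter for any other witness at `z`.
  have back : ∀ (g : MaxSubgroup he) (h : V.State → H) (w : V.Sgp) (x : X) (y z : RClass e),
      y ∈ (F w).carrier → (z : M) = y * ι x → R (g.elt * z) (wreathMk h (w * (v x).snd)) →
      R (g.elt * y) (wreathMk (fun q => h q * (η x (V.act q w))⁻¹) w) := by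
    rintro g h w x y z ⟨g', h', h1, -⟩ hz h2
    have := tern' g g' z y h _ h' _ w h2 (step g' y h' w x z hz h1) h1
    simpa only [mul_inv_rev, mul_assoc, inv_mul_cancel, mul_one] using this
  have injective : ∀ w x, ∀ y y' z z' : RClass e, y ∈ (F w).carrier → y' ∈ (F w).carrier →
      (z : M) = y * ι x → (z' : M) = y' * ι x →
      ((F w).rel y y' ↔ (F (w * (v x).snd)).rel z z') := by
    intro w x y y' z z' hy hy' hz hz'
    constructor
    · rintro ⟨g, h, h1, h2⟩
      exact ⟨g, _, step _ _ _ _ _ _ hz h1, step _ _ _ _ _ _ hz' h2⟩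
    · rintro ⟨g, h, h1, h2⟩
      exact ⟨g, _, back _ _ _ _ _ _ hy hz h1, back _ _ _ _ _ _ hy' hz' h2⟩
  have cross : ∀ w, IsCrossSection he (F w) := by
    rintro w y y' ⟨g, h, h1, h2⟩ ⟨g', hg'⟩
    let a := g * g' * g⁻¹
    have hay : (g.elt * y' : M) = a.elt * (g.elt * y) := by
      rw [hg', ← mul_assoc, ← MaxSubgroup.elt_mul, ← mul_assoc, ← MaxSubgroup.elt_mul]
      simp only [a, inv_mul_cancel_right]
    rw [hay] at h2
    obtain ⟨fH, fW, hf⟩ := wreathMk_surj f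
    -- Equal first coordinates cancel in the ternary operation, so `a` is related to the idempotent
    -- `f`. Hence so is the cyclic group it generates, and separation forces `a = 1`.
    have h3 := (tern a _ e h h fH w fW h2 h1 (hf ▸ hR1)).2.1
    simp only [mul_inv_cancel, one_mul] at h3
    rw [← hf, MaxSubgroup.elt_mul_idem] at h3
    have hpow : ∀ n : ℕ, ((a ^ n).elt, f) ∈ E := by
      intro n
      induction n with
      | zero => rwa [pow_zero, MaxSubgroup.elt_one]
      | succ n ih =>
        have := E.mul_mem ih h3
        rwa [Prod.mk_mul_mk, hff, ← MaxSubgroup.elt_mul, ← pow_succ] at this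
    have hP := hsep f hff (Subgroup.zpowers a) (by
      intro b hb
      obtain ⟨n, rfl⟩ := mem_powers_iff_mem_zpowers.2 hb
      exact hpow n)
    have ha : a = 1 := Subgroup.zpowers_eq_bot.1 hP
    have hg1 : g' = 1 := by
      have : g * g' = g := by simpa [a, mul_inv_eq_one] using ha
      simpa using this
    refine Subtype.ext ?_
    rw [hg', hg1, MaxSubgroup.elt_one, ((mem_rClass_iff he).1 y.2).1]
  refine ⟨A, complexityLe_sgp_of_mul hl hV _, F, ⟨⟨?_, ?_, cross⟩, ⟨?_, ?_, ?_⟩, ?_⟩, ?_⟩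
  · rintro w x _ ⟨⟩
    exact mapsTo w x
  · rintro w x _ ⟨⟩
    exact injective w x
  · rintro (_ | w) x _ ⟨⟩ y z hy hz
    · exact hy.elim
    · exact mapsTo w x y z hy hz
  · rintro (_ | w) x _ ⟨⟩ y y' z z' hy hy' hz hz'
    · exact hy.elim
    · exact injective w x y y' z z' hy hy' hz hz'
  · rintro (_ | w)
    · intro _ _ h
      exact h.elim
    · exact cross w
  · intro y
    obtain ⟨σ, hσ⟩ := htotal y
    have hy := ((mem_rClass_iff he).1 y.2).1
    have h1 := fwd e f y σ hR1 hσ (hy.symm ▸ y.2)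
    obtain ⟨a, w, ha⟩ := wreathMk_surj (f * σ)
    rw [ha] at h1
    exact ⟨w, 1, a, h1, h1⟩
  · rintro w g y y' z z' hz hz' ⟨g₀, h, h1, h2⟩
    refine ⟨g₀ * g⁻¹, h, ?_, ?_⟩
    · rwa [hz, MaxSubgroup.mul_inv_elt_mul]
    · rwa [hz', MaxSubgroup.mul_inv_elt_mul]

/-! ## The quotients `GM_J(G/N)` -/

section Quotients

variable {S : Type u} [Semigroup S] {e : S} {he : IsIdempotentElem e}

theorem MaxSubgroup.elt_mem_jClass (g : MaxSubgroup he) : g.elt ∈ JClass e :=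
  ⟨⟨1, g.elt, by rw [one_mul, ← WithOne.coe_mul, g.mul_elt]⟩,
    ⟨1, (g⁻¹).elt, by rw [one_mul, ← WithOne.coe_mul, g.elt_mul_inv]⟩⟩

/-- An element of `eSe` that divides an element of the maximal subgroup on the left within `eSe`
lies in the maximal subgroup. -/
theorem MaxSubgroup.exists_elt_of_mul [Finite S] {s t : S} (hs : e * s = s) (hs' : s * e = s)
    (ht : e * t = t) (ht' : t * e = t) {g : MaxSubgroup he} (h : s * t = g.elt) :
    (∃ a : MaxSubgroup he, s = a.elt) ∧ ∃ b : MaxSubgroup he, t = b.elt := by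
  let x : LocalMonoid he := ⟨s, hs, hs'⟩
  let y : LocalMonoid he := ⟨t, ht, ht'⟩
  have hxy : x * y = (g : LocalMonoid he) := LocalMonoid.ext h
  have hx : IsUnit x := IsUnit.of_mul_eq_one (y * (g⁻¹ : MaxSubgroup he)) (by
    rw [← mul_assoc, hxy, Units.mul_inv])
  have hy : IsUnit y := IsUnit.of_mul_eq_one_right ((g⁻¹ : MaxSubgroup he) * x) (by
    rw [mul_assoc, hxy, Units.inv_mul])
  obtain ⟨a, ha⟩ := hx
  obtain ⟨b, hb⟩ := hy
  exact ⟨⟨a, congrArg LocalMonoid.val ha.symm⟩, ⟨b, congrArg LocalMonoid.val hb.symm⟩⟩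

/-- If `x` lies in a coset of `N`, then `y` lies in the same coset. -/
def CosetImp (N : Subgroup (MaxSubgroup he)) (x y : WithOne S) : Prop :=
  ∀ g : MaxSubgroup he, x = (g.elt : WithOne S) →
    ∃ h : MaxSubgroup he, g⁻¹ * h ∈ N ∧ y = (h.elt : WithOne S)

theorem CosetImp.trans {N : Subgroup (MaxSubgroup he)} {x y z : WithOne S}
    (h : CosetImp N x y) (h' : CosetImp N y z) : CosetImp N x z := by
  intro g hg
  obtain ⟨a, ha, ha'⟩ := h g hg
  obtain ⟨b, hb, hb'⟩ := h' a ha'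
  exact ⟨b, by simpa [mul_assoc] using N.mul_mem ha hb, hb'⟩

/-- The syntactic congruence of the set of cosets of `N`. -/
def cosetSyntacticCon (N : Subgroup (MaxSubgroup he)) : Con S where
  r s t := ∀ a b : WithOne S, CosetImp N (a * s * b) (a * t * b) ∧ CosetImp N (a * t * b) (a * s * b)
  iseqv :=
    { refl := fun s a b => ⟨fun g hg => ⟨g, by simp [N.one_mem], hg⟩,
        fun g hg => ⟨g, by simp [N.one_mem], hg⟩⟩
      symm := fun h a b => (h a b).symm
      trans := fun h h' a b => ⟨(h a b).1.trans (h' a b).1, (h' a b).2.trans (h a b).2⟩ }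
  mul' := by
    intro w x y z h h' a b
    have h1 := h a (y * b)
    have h2 := h' (a * x) b
    simp only [WithOne.coe_mul, mul_assoc] at h1 h2 ⊢
    exact ⟨h1.1.trans h2.1, h2.2.trans h1.2⟩

/-- If $agb$ lies in $G$, then by finiteness both $ae$ and $eb$ lie in $G$. Replacing $g$ by $h$
then moves the product within its coset, by normality of $N$. -/
theorem cosetImp_elt [Finite S] {N : Subgroup (MaxSubgroup he)} (hN : N.Normal)
    {g h : MaxSubgroup he} (hgh : g⁻¹ * h ∈ N) (a b : WithOne S) :
    CosetImp N (a * g.elt * b) (a * h.elt * b) := by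
  obtain ⟨α, hα, hαe⟩ : ∃ α : S, a * (e : WithOne S) = α ∧ α * e = α := by
    obtain rfl | ⟨a, rfl⟩ := eq_one_or_coe a
    · exact ⟨e, one_mul _, he⟩
    · exact ⟨a * e, (WithOne.coe_mul _ _).symm, by rw [mul_assoc, he.eq]⟩
  obtain ⟨β, hβ, hβe⟩ : ∃ β : S, (e : WithOne S) * b = β ∧ e * β = β := by
    obtain rfl | ⟨b, rfl⟩ := eq_one_or_coe b
    · exact ⟨e, mul_one _, he⟩
    · exact ⟨e * b, (WithOne.coe_mul _ _).symm, by rw [← mul_assoc, he.eq]⟩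
  have key : ∀ x : MaxSubgroup he, a * (x.elt : WithOne S) * b = ((α * x.elt * β : S) : WithOne S) := by
    intro x
    have hx : (x.elt : WithOne S) = e * x.elt * e := by
      rw [← WithOne.coe_mul, ← WithOne.coe_mul, x.mul_elt, x.elt_mul_idem]
    rw [WithOne.coe_mul, WithOne.coe_mul, ← hα, ← hβ]
    conv_lhs => rw [hx]
    simp only [mul_assoc]
  intro m hm
  rw [key, WithOne.coe_inj] at hm
  obtain ⟨⟨p, hp⟩, q, hq⟩ := MaxSubgroup.exists_elt_of_mul (he := he) (s := e * α * g.elt)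
    (t := β * e) (g := m) (by rw [← mul_assoc, ← mul_assoc, he.eq])
    (by rw [mul_assoc, g.elt_mul_idem]) (by rw [← mul_assoc, hβe]) (by rw [mul_assoc, he.eq]) (by
      rw [mul_assoc e, mul_assoc e, ← mul_assoc _ β, hm, m.elt_mul_idem, m.mul_elt])
  have hαg : α = (m * q⁻¹ * g⁻¹).elt := by
    rw [MaxSubgroup.elt_mul, MaxSubgroup.elt_mul, ← m.elt_mul_idem, ← hm, mul_assoc _ β, hq,
      mul_assoc _ q.elt, q.elt_mul_inv, mul_assoc α, g.elt_mul_idem, mul_assoc, g.elt_mul_inv, hαe]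
  have hβp : β = ((g⁻¹ * (m * q⁻¹ * g⁻¹)⁻¹) * m).elt := by
    rw [MaxSubgroup.elt_mul, ← hm, hαg, ← MaxSubgroup.elt_mul, ← mul_assoc, ← MaxSubgroup.elt_mul]
    simp [MaxSubgroup.elt_one, hβe]
  refine ⟨m * q⁻¹ * g⁻¹ * h * (g⁻¹ * (m * q⁻¹ * g⁻¹)⁻¹ * m), ?_, ?_⟩
  · have := hN.conj_mem _ hgh q⁻¹
    convert this using 1
    group
  · rw [key, WithOne.coe_inj, MaxSubgroup.elt_mul, MaxSubgroup.elt_mul, ← hαg, ← hβp]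

/-- The syntactic congruence of the cosets contains the generating pairs of `cosetCon`, so passing
to $S/N$ identifies nothing in $G$ beyond cosets. -/
theorem exists_elt_of_cosetCon [Finite S] {N : Subgroup (MaxSubgroup he)} (hN : N.Normal)
    {s : S} {g : MaxSubgroup he} (h : cosetCon he N g.elt s) :
    ∃ g' : MaxSubgroup he, g⁻¹ * g' ∈ N ∧ s = g'.elt := by
  have hle : cosetCon he N ≤ cosetSyntacticCon N := by
    refine Con.conGen_le.2 ?_
    -- Elements of the ideal $I(J)$ divide nothing in $J$, so the condition on them is vacuous.
    have hlow : ∀ s : S, (∀ a ∈ JClass e, ¬ JLe a s) → ∀ (a b x : WithOne S),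
        CosetImp N (a * s * b) x := fun s hs a b x g hg =>
      absurd ⟨a, b, hg.symm⟩ (hs _ g.elt_mem_jClass)
    rintro s t (⟨hs, ht⟩ | ⟨g, h, hgh, rfl, rfl⟩) a b
    · exact ⟨hlow s hs _ _ _, hlow t ht _ _ _⟩
    · exact ⟨cosetImp_elt hN hgh a b, cosetImp_elt hN (by simpa using N.inv_mem hgh) a b⟩
  obtain ⟨g', h1, h2⟩ := (hle h 1 1).1 g (by simp)
  exact ⟨g', h1, WithOne.coe_inj.1 (by simpa using h2)⟩

theorem GMQuot.mk_surjective (he : IsIdempotentElem e) (N : Subgroup (MaxSubgroup he)) :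
    Function.Surjective (GMQuot.mk he N) := Quotient.mk_surjective

theorem GMQuot.mk_mul (he : IsIdempotentElem e) (N : Subgroup (MaxSubgroup he)) (s t : S) :
    GMQuot.mk he N (s * t) = GMQuot.mk he N s * GMQuot.mk he N t := rfl

instance [Finite S] (N : Subgroup (MaxSubgroup he)) : Finite (GMQuot he N) :=
  Finite.of_surjective _ (GMQuot.mk_surjective he N)

/-- Test the $\mathrm{GM}$ congruence with $x=y=e$: since $ege=g$ stays in the image of $J$, also
$ese$ is congruent to $g$ in $S/N$. -/
theorem GMQuot.exists_elt_of_mk_eq [Finite S] {N : Subgroup (MaxSubgroup he)} (hN : N.Normal)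
    (htop : N ≠ ⊤) {s : S} {g : MaxSubgroup he} (h : GMQuot.mk he N g.elt = GMQuot.mk he N s) :
    ∃ g' : MaxSubgroup he, g⁻¹ * g' ∈ N ∧ e * s * e = g'.elt := by
  have h1 : gmQuotCon he N g.elt s := (Con.eq _).1 h
  rw [gmQuotCon, if_neg htop] at h1
  have heJ : (e : (cosetCon he N).Quotient) ∈ JClass (e : (cosetCon he N).Quotient) :=
    ⟨⟨1, 1, by simp⟩, ⟨1, 1, by simp⟩⟩
  have h2 := (h1 _ heJ _ heJ).2
  have h3 : (e : (cosetCon he N).Quotient) * (g.elt : (cosetCon he N).Quotient) * e = g.elt := by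
    rw [← Con.coe_mul, ← Con.coe_mul, g.mul_elt, g.elt_mul_idem]
  rw [h3, ← Con.coe_mul, ← Con.coe_mul] at h2
  refine exists_elt_of_cosetCon hN ((Con.eq _).1 (h2 ⟨⟨1, ((g.elt : (cosetCon he N).Quotient)), ?_⟩,
    ⟨1, (((g⁻¹).elt : (cosetCon he N).Quotient)), ?_⟩⟩))
  · rw [one_mul, ← WithOne.coe_mul, ← Con.coe_mul, g.mul_elt]
  · rw [one_mul, ← WithOne.coe_mul, ← Con.coe_mul, g.elt_mul_inv]

theorem GMQuot.mk_elt_eq {N : Subgroup (MaxSubgroup he)} (htop : N ≠ ⊤) {g h : MaxSubgroup he}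
    (hgh : g⁻¹ * h ∈ N) : GMQuot.mk he N g.elt = GMQuot.mk he N h.elt := by
  refine (Con.eq _).2 ?_
  rw [gmQuotCon, if_neg htop]
  have : (g.elt : (cosetCon he N).Quotient) = h.elt :=
    (Con.eq _).2 (ConGen.Rel.of _ _ (Or.inr ⟨g, h, hgh, rfl, rfl⟩))
  change gmCon _ (g.elt : (cosetCon he N).Quotient) (h.elt : (cosetCon he N).Quotient)
  rw [this]
  exact Con.refl _ _

theorem GMQuot.subsingleton_top {N : Subgroup (MaxSubgroup he)} (htop : N = ⊤) :
    Subsingleton (GMQuot he N) := by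
  refine ⟨fun a b => ?_⟩
  obtain ⟨s, rfl⟩ := GMQuot.mk_surjective he N a
  obtain ⟨t, rfl⟩ := GMQuot.mk_surjective he N b
  refine (Con.eq _).2 ?_
  rw [gmQuotCon, if_pos htop]
  trivial

/-- Elements of the maximal subgroup of `GM_J(G/N)` lift to `G`. -/
theorem GMQuot.exists_elt_of_mk_eq_elt [Finite S] {N : Subgroup (MaxSubgroup he)} (hN : N.Normal)
    (htop : N ≠ ⊤) {s : S} {p : MaxSubgroup (GMQuot.idem he N)} (h : GMQuot.mk he N s = p.elt) :
    ∃ g : MaxSubgroup he, e * s * e = g.elt := by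
  obtain ⟨t, ht⟩ := GMQuot.mk_surjective he N (p⁻¹).elt
  obtain ⟨g, -, hg⟩ := GMQuot.exists_elt_of_mk_eq hN htop (g := 1) (s := s * e * t) (by
    rw [GMQuot.mk_mul, GMQuot.mk_mul, h, ht, p.elt_mul_idem, p.elt_mul_inv]
    rfl)
  refine (MaxSubgroup.exists_elt_of_mul (g := g) (t := e * t * e) ?_ ?_ ?_ ?_ ?_).1
  · rw [← mul_assoc, ← mul_assoc, he.eq]
  · rw [mul_assoc, he.eq]
  · rw [← mul_assoc, ← mul_assoc, he.eq]
  · rw [mul_assoc, he.eq]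
  · rw [← hg, mul_assoc e t, ← mul_assoc (e * s * e) e, mul_assoc (e * s) e e, he.eq]
    simp only [mul_assoc]

/-- The homomorphism from `G` to the maximal subgroup of `GM_J(G/N)`, on elements. -/
noncomputable def MaxSubgroup.toGMQuot (N : Subgroup (MaxSubgroup he)) (g : MaxSubgroup he) :
    MaxSubgroup (GMQuot.idem he N) where
  val := ⟨GMQuot.mk he N g.elt, congrArg (GMQuot.mk he N) g.mul_elt,
    congrArg (GMQuot.mk he N) g.elt_mul_idem⟩
  inv := ⟨GMQuot.mk he N (g⁻¹).elt, congrArg (GMQuot.mk he N) (g⁻¹).mul_elt,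
    congrArg (GMQuot.mk he N) (g⁻¹).elt_mul_idem⟩
  val_inv := LocalMonoid.ext (congrArg (GMQuot.mk he N) g.elt_mul_inv)
  inv_val := LocalMonoid.ext (congrArg (GMQuot.mk he N) g.inv_elt_mul)

theorem GMQuot.closure_range (he : IsIdempotentElem e) (N : Subgroup (MaxSubgroup he)) {X : Set S}
    (hX : Subsemigroup.closure X = ⊤) :
    Subsemigroup.closure (Set.range fun x : X => GMQuot.mk he N x) = ⊤ := by
  refine (Subsemigroup.eq_top_iff' _).2 fun m => ?_
  obtain ⟨s, rfl⟩ := GMQuot.mk_surjective he N m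
  have hs : s ∈ Subsemigroup.closure X := hX ▸ Subsemigroup.mem_top s
  induction hs using Subsemigroup.closure_induction with
  | mem s hs => exact Subsemigroup.subset_closure ⟨⟨s, hs⟩, rfl⟩
  | mul s t _ _ hs ht => exact Subsemigroup.mul_mem _ hs ht

end Quotients

/-! ## Pointlike subsets of the maximal subgroup -/

section Pointlike

variable {S : Type u} [Semigroup S] {e : S} {he : IsIdempotentElem e} {k : ℕ}

/-- A subset of the maximal subgroup at `e` is pointlike with respect to `C_k`. -/
def IsGroupPointlike (k : ℕ) (Z : Set (MaxSubgroup he)) : Prop :=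
  IsPointlike k {s : S | ∃ g ∈ Z, s = g.elt}

theorem isGroupPointlike_singleton (g : MaxSubgroup he) : IsGroupPointlike k {g} := by
  intro T _ _ _ r
  obtain ⟨t, ht⟩ := r.total g.elt
  refine ⟨t, ?_⟩
  rintro _ ⟨_, rfl, rfl⟩
  exact ht

open Pointwise in
theorem IsGroupPointlike.mul {Y Z : Set (MaxSubgroup he)} (hY : IsGroupPointlike k Y)
    (hZ : IsGroupPointlike k Z) : IsGroupPointlike k (Y * Z) := by
  intro T _ _ hT r
  obtain ⟨t, ht⟩ := hY T hT r
  obtain ⟨t', ht'⟩ := hZ T hT r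
  refine ⟨t * t', ?_⟩
  rintro _ ⟨_, ⟨y, hy, z, hz, rfl⟩, rfl⟩
  exact r.mul _ _ _ _ (ht _ ⟨y, hy, rfl⟩) (ht' _ ⟨z, hz, rfl⟩)

open Pointwise in
/-- There is a largest subset of the maximal subgroup that contains `1` and is pointlike, and it is
a normal subgroup. -/
theorem exists_largest_isGroupPointlike [Finite S] (he : IsIdempotentElem e) (k : ℕ) :
    ∃ N : Subgroup (MaxSubgroup he), N.Normal ∧ IsGroupPointlike k (N : Set (MaxSubgroup he)) ∧
      ∀ Z : Set (MaxSubgroup he), 1 ∈ Z → IsGroupPointlike k Z → Z ⊆ N := by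
  obtain ⟨Z, ⟨h1, hZ⟩, hmax⟩ := Set.exists_max_image
    {Z : Set (MaxSubgroup he) | 1 ∈ Z ∧ IsGroupPointlike k Z} Set.ncard (Set.toFinite _)
    ⟨{1}, rfl, isGroupPointlike_singleton 1⟩
  -- $Z\subseteq ZY$ and both are pointlike, so the maximal size of $Z$ gives equality.
  have hsub : ∀ Y : Set (MaxSubgroup he), 1 ∈ Y → IsGroupPointlike k Y → Z * Y = Z :=
    fun Y hY hpY => (Set.eq_of_subset_of_ncard_le (Set.subset_mul_left Z hY)
      (hmax _ ⟨⟨1, h1, 1, hY, mul_one 1⟩, hZ.mul hpY⟩) (Set.toFinite _)).symm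
  have hlarge : ∀ Y : Set (MaxSubgroup he), 1 ∈ Y → IsGroupPointlike k Y → Y ⊆ Z :=
    fun Y hY hpY => (Set.subset_mul_right Y h1).trans (hsub Y hY hpY).subset
  let M : Submonoid (MaxSubgroup he) :=
    ⟨⟨Z, fun {a b} ha hb => (hsub Z h1 hZ).subset ⟨a, ha, b, hb, rfl⟩⟩, h1⟩
  refine ⟨⟨M, fun {a} ha => ?_⟩, ⟨fun a ha g => ?_⟩, hZ, hlarge⟩
  · have : Submonoid.powers a ≤ M := Submonoid.powers_le.2 ha
    exact this (mem_powers_iff_mem_zpowers.2 (inv_mem (Subgroup.mem_zpowers a)))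
  · refine hlarge ({g} * Z * {g⁻¹}) ⟨g * 1, ⟨g, rfl, 1, h1, rfl⟩, g⁻¹, rfl, by simp⟩
      (((isGroupPointlike_singleton g).mul hZ).mul (isGroupPointlike_singleton g⁻¹)) ?_
    exact ⟨g * a, ⟨g, rfl, a, ha, rfl⟩, g⁻¹, rfl, rfl⟩

/-- If `N` is the largest pointlike subgroup of `G`, then the maximal subgroup of `GM_J(G/N)` has no
non-trivial pointlike subgroups. -/
theorem gmQuot_isPointlike_eq_bot [Finite S] {N : Subgroup (MaxSubgroup he)} (hN : N.Normal)
    (hp : IsGroupPointlike k (N : Set (MaxSubgroup he)))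
    (hlarge : ∀ Z : Set (MaxSubgroup he), 1 ∈ Z → IsGroupPointlike k Z → Z ⊆ N)
    (P : Subgroup (MaxSubgroup (GMQuot.idem he N)))
    (hP : IsPointlike k {s : GMQuot he N | ∃ g ∈ P, s = g.elt}) : P = ⊥ := by
  refine (Subgroup.eq_bot_iff_forall _).2 fun p hpP => MaxSubgroup.elt_injective ?_
  by_cases htop : N = ⊤
  · have := GMQuot.subsingleton_top htop
    exact Subsingleton.elim _ _
  -- The full preimage of `P` in $G$ is pointlike too, so it lies in $N$ by maximality, and `P` is
  -- trivial.
  have hZ : IsGroupPointlike k {g : MaxSubgroup he | ∃ p ∈ P, GMQuot.mk he N g.elt = p.elt} := by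
    intro T _ _ hT r
    obtain ⟨t, ht⟩ := hP T hT ⟨fun m t => ∃ s, GMQuot.mk he N s = m ∧ r.rel s t, fun m => by
      obtain ⟨s, rfl⟩ := GMQuot.mk_surjective he N m
      obtain ⟨t, ht⟩ := r.total s
      exact ⟨t, s, rfl, ht⟩, by
      rintro _ t _ t' ⟨s, rfl, hs⟩ ⟨s', rfl, hs'⟩
      exact ⟨s * s', rfl, r.mul _ _ _ _ hs hs'⟩⟩
    obtain ⟨tN, htN⟩ := hp T hT r
    obtain ⟨u, hu⟩ := r.total e
    -- `t` is only related to some `s` over the image of `g`. Sandwiching by `u` replaces `s` by `e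
    -- * s * e`, an element of the coset of `g`, and the factor `tN`, related to all of `N`,
    -- corrects it to `g`.
    refine ⟨tN * (u * t * u), ?_⟩
    rintro _ ⟨g, ⟨p, hpP, hgp⟩, rfl⟩
    obtain ⟨s, hs, hst⟩ := ht _ ⟨p, hpP, rfl⟩
    obtain ⟨a, ha⟩ := GMQuot.exists_elt_of_mk_eq_elt hN htop hs
    obtain ⟨b, hb, hb'⟩ := GMQuot.exists_elt_of_mk_eq hN htop (hgp.trans hs.symm)
    have hga : g = (g * b⁻¹) * b := by simp
    rw [hga, MaxSubgroup.elt_mul, ← hb']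
    refine r.mul _ _ _ _ (htN _ ⟨_, ?_, rfl⟩) (r.mul _ _ _ _ (r.mul _ _ _ _ hu hst) hu)
    have := hN.conj_mem _ (N.inv_mem hb) g
    simpa [mul_assoc] using this
  obtain ⟨s, hs⟩ := GMQuot.mk_surjective he N p.elt
  obtain ⟨g, hg⟩ := GMQuot.exists_elt_of_mk_eq_elt hN htop hs
  have hgp : GMQuot.mk he N g.elt = p.elt := by
    rw [← hg, GMQuot.mk_mul, GMQuot.mk_mul, hs]
    exact (congrArg (· * _) p.mul_elt).trans p.elt_mul_idem
  have hgN : g ∈ N := hlarge _ (by exact ⟨1, P.one_mem, rfl⟩) hZ ⟨p, hpP, hgp⟩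
  rw [← hgp]
  exact (GMQuot.mk_elt_eq htop (g := 1) (h := g) (by simpa using hgN)).symm

/-- Pointlike sets map to pointlike sets in the quotient. There the flow collapses the image of `P`
to a point, and the kernel on $G$ is contained in $N$. -/
theorem le_of_mem_flowNormals [Finite S] {X : Set S} (hX : Subsemigroup.closure X = ⊤)
    {N : Subgroup (MaxSubgroup he)} (hN : N ∈ flowNormals he X k) {P : Subgroup (MaxSubgroup he)}
    (hP : IsPointlike (k + 1) {s : S | ∃ g ∈ P, s = g.elt}) : P ≤ N := by
  obtain ⟨hN, hflow⟩ := hN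
  by_cases htop : N = ⊤
  · exact htop ▸ le_top
  have hsub := hflow.subsingleton_of_isPointlike (GMQuot.closure_range he N hX)
    (Z := MaxSubgroup.toGMQuot N '' P) (by
      intro T _ _ hT r
      let r' : RelMorphism S T := ⟨fun s t => r.rel (GMQuot.mk he N s) t, fun s => r.total _,
        fun _ _ _ _ h h' => r.mul _ _ _ _ h h'⟩
      obtain ⟨t, ht⟩ := hP T hT r'
      refine ⟨t, ?_⟩
      rintro _ ⟨_, ⟨g, hg, rfl⟩, rfl⟩
      exact ht g.elt ⟨g, hg, rfl⟩)
  intro g hg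
  have h1 := hsub (Set.mem_image_of_mem _ P.one_mem) (Set.mem_image_of_mem _ hg)
  obtain ⟨g', h2, h3⟩ := GMQuot.exists_elt_of_mk_eq hN htop (g := 1) (s := g.elt)
    (congrArg MaxSubgroup.elt h1)
  rw [g.mul_elt, g.elt_mul_idem] at h3
  obtain rfl := MaxSubgroup.elt_injective h3
  simpa using h2

end Pointlike

end KRComplexity

/-! ### The theorem. -/

theorem mainTheorem4 {S : Type u} [SemigroupWithZero S] [Finite S] (J : Set S)
    (hS : KRComplexity.IsGM J) (X : Set S) (hX : Subsemigroup.closure X = ⊤)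
    {e : S} (he : IsIdempotentElem e) (heJ : e ∈ J) (k : ℕ) (hk : 0 < k) :
    IsLeast (KRComplexity.flowNormals he X (k - 1)) (KRComplexity.flowNormal he X k) ∧
    IsGreatest
      {P : Subgroup (KRComplexity.MaxSubgroup he) |
        KRComplexity.IsPointlike k {s : S | ∃ g ∈ P, s = KRComplexity.MaxSubgroup.elt g}}
      (KRComplexity.flowNormal he X k) := by
  open KRComplexity in
  obtain ⟨k, rfl⟩ := Nat.exists_eq_succ_of_ne_zero hk.ne'
  obtain ⟨N, hN, hp, hlarge⟩ := exists_largest_isGroupPointlike he (k + 1)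
  have hmem : N ∈ flowNormals he X k := ⟨hN, admitsFlow_of_pointlike_trivial _
    (GMQuot.closure_range he N hX) (gmQuot_isPointlike_eq_bot hN hp hlarge)⟩
  have hleast : IsLeast (flowNormals he X k) N :=
    ⟨hmem, fun N' hN' => le_of_mem_flowNormals hX hN' hp⟩
  -- A least element of the family equals the intersection that defines `flowNormal`.
  have heq : flowNormal he X (k + 1) = N := hleast.isGLB.sInf_eq
  rw [Nat.succ_eq_add_one, heq]
  exact ⟨hleast, hp, fun P hP => hlarge P P.one_mem hP⟩
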